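/- Let $f\in C([0,1])$ satisfy $f(0)=f(1)=0$, $f>0$ on $(0,1)$ (type A), and $|f(s)|\le ks$, $|f(s)|\le k(1-s)$ on $[0,1]$ for some $k>0$. Assume moreover (F): $f$ is locally Lipschitz continuous on $(0,1)$ and has a unique local maximum point $v_{\max}\in(0,1)$. Set $F(v)=\int_0^v f(s)\,ds$ and $\mathcal V_0=1/2$. For $\varepsilon>0$, call $c\in\mathbb R$ an admissible speed if the problem $$y'=c\,\frac{\sqrt{y(2\varepsilon+y)}}{\varepsilon+y}-f(v),\qquad y(0)=y(1)=0,\qquad y>0\ \text{on }(0,1),$$ has a solution $y=y(v)$ on $[0,1]$. Then the set of admissible speeds is an interval $[c^*_\varepsilon,+\infty)$; $c^*_\varepsilon$ is called the critical speed. The equation $$\varepsilon\left(\frac{v'}{\sqrt{1-(v')^2}}\right)'-c^*_\varepsilon v'+f(v)=0$$ has a unique nondecreasing $C^2$ solution $v_\varepsilon:\mathbb R\to[0,1]$ with $|v_\varepsilon'|<1$, $v_\varepsilon(-\infty)=0$, $v_\varepsilon(+\infty)=1$ and $v_\varepsilon(0)=\mathcal V_0$; it is called the critical profile. The equation $F(v)=vf(v)$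 has a largest solution $v_+$ in $[0,1]$, and $v_+\in(0,1)$. As $\varepsilon\to0^+$, one has $c^*_\varepsilon\to f(v_+)$. For $\underline z\in\mathbb R$ and $\underline v\in(0,1)$, let $$\mathcal V_L(z;\underline z,\underline v)=\begin{cases}0,& z<\underline z-\underline v,\\ z-\underline z+\underline v,& \underline z-\underline v\le z\le 1+\underline z-\underline v,\\ 1,& z>1+\underline z-\underline v,\end{cases}$$ and let $\mathcal V_I(\cdot;\underline z,\underline v):\mathbb R\to(0,1]$ be the unique solution of $f(v_+)\,v'=f(v)$, $v(\underline z)=\underline v$. Then, as $\varepsilon\to0^+$, $v_\varepsilon\to\bar v$ uniformly on $\mathbb R$, where: - if $v_+\ge\mathcal V_0$, then $\bar v(z)=\mathcal V_L(z;0,\mathcal V_0)$ for $z\le v_+-\mathcal V_0$ and $\bar v(z)=\mathcal V_I(z;v_+-\mathcal V_0,v_+)$ for $z>v_+-\mathcal V_0$; - if $v_+<\mathcal V_0$, then $\bar v(z)=\mathcal V_L(z;z_+,v_+)$ for $z\le z_+$ and $\bar v(z)=\mathcal V_I(z;0,\mathcal V_0)$ for $z>z_+$, where $z_+<0$ is the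 unique real number with $\mathcal V_I(z_+;0,\mathcal V_0)=v_+$. In both cases the gluing is $C^1$: $\bar v$ is of class $C^1$ in a neighbourhood of the gluing point (respectively $v_+-\mathcal V_0$ and $z_+$), and its derivative there equals $1$. -/

import Mathlib

/-!
Along a positive solution of `y' = c R_ε(y) - f` the function `y + F - c v` decreases strictly,
because `R_ε < 1`. Hence `F(v) < c v` on `(0, 1)`; at the tangency point `v₊`, where
`F(v₊) = v₊ f(v₊)`, this gives `f(v₊) < c`. Conversely `√(ε² + q²) - ε` with
`q(v) = (f(v₊) + √(k ε)) v - F(v)` is a supersolution at the speed `f(v₊) + √(4 k ε)`, so the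
critical speeds are squeezed to `f(v₊)`.

The critical profile solves the autonomous equation `v' = R_ε(y_ε(v))`, so its inverse is the time
map `s ↦ ∫ dr / R_ε(y_ε(r))`, the integral running from the normalization value to `s`. As
`ε → 0⁺`, `R_ε(y_ε(s))` tends to `f(max s v₊) / f(v₊)`: below `v₊` the solutions `y_ε` stay away
from `0`, and above it they stay just under the nullcline `c R_ε(y) = f`. By dominated convergence
the time maps converge, hence so do the profiles pointwise; being monotone, with a continuous
monotone limit having the same limits at `±∞`, they converge uniformly.
-/

open Set Filter Topology

noncomputable section

/-- Regularity, zeros and linear controls of the reaction term `f : [0, 1] → ℝ`.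
Throughout, only the values of `f` on `[0, 1]` matter. -/
structure ConditionH (f : ℝ → ℝ) : Prop where
  continuousOn : ContinuousOn f (Icc 0 1)
  zero : f 0 = 0
  one : f 1 = 0
  linear_control : ∃ k : ℝ, 0 < k ∧ ∀ s ∈ Icc (0 : ℝ) 1, |f s| ≤ k * s ∧ |f s| ≤ k * (1 - s)

/-- Type A (monostable) reaction terms. -/
def IsTypeA (f : ℝ → ℝ) : Prop :=
  ∀ s ∈ Ioo (0 : ℝ) 1, 0 < f s

/-- `f` is locally Lipschitz and has a unique (not necessarily strict) local maximum point,
which lies in `(0, 1)`. Local Lipschitz continuity is only required inside the interval; the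
end points `0`, `1` cannot be local maximum points of a type A term on `[0, 1]`. -/
structure ConditionF (f : ℝ → ℝ) : Prop where
  locallyLipschitzOn : LocallyLipschitzOn (Ioo 0 1) f
  unique_localMax : ∃! m : ℝ, m ∈ Ioo (0 : ℝ) 1 ∧ IsLocalMax f m

/-- The primitive `F(v) = ∫₀ᵛ f(s) ds`. -/
def primitive (f : ℝ → ℝ) (v : ℝ) : ℝ :=
  ∫ s in (0 : ℝ)..v, f s

/-- The nonlinearity `√(y (2ε + y)) / (ε + y)` of the first-order reduction. -/
def reductionR (ε y : ℝ) : ℝ :=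
  √(y * (2 * ε + y)) / (ε + y)

/-- `c` is an admissible speed: the first-order two-point problem
`y' = c √(y (2ε + y)) / (ε + y) - f(v)`, `y(0) = y(1) = 0`, `y > 0` on `(0, 1)`,
has a solution. -/
def IsAdmissibleSpeed (f : ℝ → ℝ) (ε c : ℝ) : Prop :=
  ∃ y : ℝ → ℝ, ContinuousOn y (Icc 0 1) ∧ y 0 = 0 ∧ y 1 = 0 ∧
    ∀ v ∈ Ioo (0 : ℝ) 1, 0 < y v ∧ HasDerivAt y (c * reductionR ε (y v) - f v) v

/-- `c` is the critical speed: the admissible speeds are exactly the interval `[c, +∞)`. -/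
def IsCriticalSpeed (f : ℝ → ℝ) (ε c : ℝ) : Prop :=
  {c' : ℝ | IsAdmissibleSpeed f ε c'} = Ici c

/-- Monotone heteroclinics: classical nondecreasing solutions `v` on the whole line of
`ε (v' / √(1 - v'²))' - c v' + f(v) = 0` with `v(-∞) = 0` and `v(+∞) = 1`. -/
structure IsHeteroclinic (f : ℝ → ℝ) (ε c : ℝ) (v : ℝ → ℝ) : Prop where
  contDiff : ContDiff ℝ 2 v
  abs_deriv_lt_one : ∀ z, |deriv v z| < 1
  equation : ∀ z,
    ε * deriv (fun x => deriv v x / √(1 - (deriv v x) ^ 2)) z - c * deriv v z + f (v z) = 0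
  monotone : Monotone v
  tendsto_atBot : Tendsto v atBot (𝓝 0)
  tendsto_atTop : Tendsto v atTop (𝓝 1)

/-- The normalization value at `z = 0` for type A reaction terms. -/
def normV0 : ℝ := 1 / 2

/-- The normalized front profile at speed `c`. -/
def IsNormalizedProfile (f : ℝ → ℝ) (ε c : ℝ) (v : ℝ → ℝ) : Prop :=
  IsHeteroclinic f ε c v ∧ v 0 = normV0

/-- The piecewise linear profile `𝒱_L(z; z₀, v₀)`. -/
def profileL (z₀ v₀ z : ℝ) : ℝ :=
  if z < z₀ - v₀ then 0 else if z ≤ 1 + z₀ - v₀ then z - z₀ + v₀ else 1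

/-- `V` is a positive solution on `ℝ` of the inviscid problem `c V' = f(V)`, `V(z₀) = v₀`, with
values where `f` is given, that is, in `[0, 1]`. -/
structure IsInviscidSolution (f : ℝ → ℝ) (c z₀ v₀ : ℝ) (V : ℝ → ℝ) : Prop where
  pos : ∀ z, 0 < V z
  le_one : ∀ z, V z ≤ 1
  differentiable : Differentiable ℝ V
  equation : ∀ z, c * deriv V z = f (V z)
  initial : V z₀ = v₀

/-- `V` is the profile `𝒱_I(·; z₀, v₀)`, the unique positive solution of the inviscid problem. -/
def IsProfileI (f : ℝ → ℝ) (c z₀ v₀ : ℝ) (V : ℝ → ℝ) : Prop :=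
  IsInviscidSolution f c z₀ v₀ V ∧ ∀ W : ℝ → ℝ, IsInviscidSolution f c z₀ v₀ W → W = V

/-- The function equal to `g` on `(-∞, z₀]` and to `h` on `(z₀, +∞)`. -/
def glue (z₀ : ℝ) (g h : ℝ → ℝ) (z : ℝ) : ℝ :=
  if z ≤ z₀ then g z else h z

/-- The profiles `v ε` converge to `vbar` uniformly on `ℝ` as `ε → 0⁺`, and `vbar` is of class
`C¹` around the point `z₀`, with slope `1` there. -/
def ConvergesToGluing (v : ℝ → ℝ → ℝ) (vbar : ℝ → ℝ) (z₀ : ℝ) : Prop :=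
  TendstoUniformly v vbar (𝓝[>] (0 : ℝ)) ∧ ContDiffAt ℝ 1 vbar z₀ ∧ deriv vbar z₀ = 1

end

/-! ### Autonomous scalar equations -/

/-- A positive speed on `(a, b)` vanishing at most linearly at both end points, so that the
solutions of `v' = G(v)` with values in `(a, b)` are defined on the whole line. -/
structure IsSpeedField (G : ℝ → ℝ) (a b : ℝ) : Prop where
  continuousOn : ContinuousOn G (Ioo a b)
  pos : ∀ s ∈ Ioo a b, 0 < G s
  bound : ∃ K : ℝ, 0 < K ∧ ∀ s ∈ Ioo a b, G s ≤ K * (s - a) ∧ G s ≤ K * (b - s)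

/-- The time needed by the solutions of `v' = G(v)` to go from `s₀` to `s`. -/
noncomputable def timeMap (G : ℝ → ℝ) (s₀ s : ℝ) : ℝ :=
  ∫ r in s₀..s, (G r)⁻¹

section timeMap

variable {G : ℝ → ℝ} {a b s₀ s : ℝ}

lemma timeMap_self (G : ℝ → ℝ) (s₀ : ℝ) : timeMap G s₀ s₀ = 0 :=
  intervalIntegral.integral_same

lemma intervalIntegrable_inv (hc : ContinuousOn G (Ioo a b)) (hp : ∀ r ∈ Ioo a b, 0 < G r)
    (hs₀ : s₀ ∈ Ioo a b) (hs : s ∈ Ioo a b) :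
    IntervalIntegrable (fun r => (G r)⁻¹) MeasureTheory.volume s₀ s :=
  ((hc.inv₀ fun r hr => (hp r hr).ne').mono
    (ordConnected_Ioo.uIcc_subset hs₀ hs)).intervalIntegrable

lemma hasDerivAt_timeMap (hc : ContinuousOn G (Ioo a b)) (hp : ∀ r ∈ Ioo a b, 0 < G r)
    (hs₀ : s₀ ∈ Ioo a b) (hs : s ∈ Ioo a b) : HasDerivAt (timeMap G s₀) (G s)⁻¹ s := by
  have hinv : ContinuousOn (fun r => (G r)⁻¹) (Ioo a b) := hc.inv₀ fun r hr => (hp r hr).ne'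
  exact intervalIntegral.integral_hasDerivAt_right (intervalIntegrable_inv hc hp hs₀ hs)
    (hinv.stronglyMeasurableAtFilter isOpen_Ioo s hs) (hinv.continuousAt (isOpen_Ioo.mem_nhds hs))

lemma continuousOn_timeMap (hc : ContinuousOn G (Ioo a b)) (hp : ∀ r ∈ Ioo a b, 0 < G r)
    (hs₀ : s₀ ∈ Ioo a b) : ContinuousOn (timeMap G s₀) (Ioo a b) :=
  HasDerivAt.continuousOn fun _ hs => hasDerivAt_timeMap hc hp hs₀ hs

lemma strictMonoOn_timeMap (hc : ContinuousOn G (Ioo a b)) (hp : ∀ r ∈ Ioo a b, 0 < G r)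
    (hs₀ : s₀ ∈ Ioo a b) : StrictMonoOn (timeMap G s₀) (Ioo a b) := by
  refine strictMonoOn_of_hasDerivWithinAt_pos (f' := fun s => (G s)⁻¹) (convex_Ioo a b)
    (continuousOn_timeMap hc hp hs₀) (fun s hs => ?_) fun s hs => ?_ <;> rw [interior_Ioo] at hs
  · exact (hasDerivAt_timeMap hc hp hs₀ hs).hasDerivWithinAt
  · exact inv_pos.2 (hp s hs)

lemma timeMap_sub_timeMap_comp (hc : ContinuousOn G (Ioo a b)) (hp : ∀ r ∈ Ioo a b, 0 < G r)
    (hs₀ : s₀ ∈ Ioo a b) {W : ℝ → ℝ} {S : Set ℝ} (hS : IsOpen S) (hSc : Convex ℝ S)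
    (hW : ∀ z ∈ S, W z ∈ Ioo a b) (hd : ∀ z ∈ S, HasDerivAt W (G (W z)) z)
    {z z₀ : ℝ} (hz : z ∈ S) (hz₀ : z₀ ∈ S) :
    timeMap G s₀ (W z) - timeMap G s₀ (W z₀) = z - z₀ := by
  have hd' : ∀ x ∈ S, HasDerivAt (fun x => timeMap G s₀ (W x) - x) 0 x := fun x hx => by
    have h := ((hasDerivAt_timeMap hc hp hs₀ (hW x hx)).comp x (hd x hx)).sub (hasDerivAt_id x)
    rwa [inv_mul_cancel₀ (hp _ (hW x hx)).ne', sub_self] at h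
  have hconst := hS.is_const_of_deriv_eq_zero hSc.isPreconnected
    (fun x hx => (hd' x hx).differentiableAt.differentiableWithinAt)
    (fun x hx => (hd' x hx).deriv) hz hz₀
  linarith

end timeMap

namespace IsSpeedField

variable {G : ℝ → ℝ} {a b s₀ K : ℝ}

lemma monotoneOn_timeMap_add_log (h : IsSpeedField G a b) (hs₀ : s₀ ∈ Ioo a b)
    (hK : ∀ s ∈ Ioo a b, G s ≤ K * (b - s)) :
    MonotoneOn (fun s => K * timeMap G s₀ s + Real.log (b - s)) (Ioo a b) := by
  have hd : ∀ s ∈ Ioo a b, HasDerivAt (fun s => K * timeMap G s₀ s + Real.log (b - s))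
      (K * (G s)⁻¹ + -1 / (b - s)) s := fun s hs =>
    ((hasDerivAt_timeMap h.continuousOn h.pos hs₀ hs).const_mul K).add
      (((hasDerivAt_id s).const_sub b).log (sub_pos.2 hs.2).ne')
  refine monotoneOn_of_hasDerivWithinAt_nonneg (convex_Ioo a b) (HasDerivAt.continuousOn hd)
    (fun s hs => (hd s (interior_subset hs)).hasDerivWithinAt) fun s hs => ?_
  have hs : s ∈ Ioo a b := interior_subset hs
  have hG := h.pos s hs
  have hbs : 0 < b - s := sub_pos.2 hs.2
  rw [show K * (G s)⁻¹ + -1 / (b - s) = (K * (b - s) - G s) / (G s * (b - s)) by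
    field_simp
    ring]
  exact div_nonneg (sub_nonneg.2 (hK s hs)) (by positivity)

lemma monotoneOn_timeMap_sub_log (h : IsSpeedField G a b) (hs₀ : s₀ ∈ Ioo a b)
    (hK : ∀ s ∈ Ioo a b, G s ≤ K * (s - a)) :
    MonotoneOn (fun s => K * timeMap G s₀ s - Real.log (s - a)) (Ioo a b) := by
  have hd : ∀ s ∈ Ioo a b, HasDerivAt (fun s => K * timeMap G s₀ s - Real.log (s - a))
      (K * (G s)⁻¹ - 1 / (s - a)) s := fun s hs =>
    ((hasDerivAt_timeMap h.continuousOn h.pos hs₀ hs).const_mul K).sub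
      (((hasDerivAt_id s).sub_const a).log (sub_pos.2 hs.1).ne')
  refine monotoneOn_of_hasDerivWithinAt_nonneg (convex_Ioo a b) (HasDerivAt.continuousOn hd)
    (fun s hs => (hd s (interior_subset hs)).hasDerivWithinAt) fun s hs => ?_
  have hs : s ∈ Ioo a b := interior_subset hs
  have hG := h.pos s hs
  have has : 0 < s - a := sub_pos.2 hs.1
  rw [show K * (G s)⁻¹ - 1 / (s - a) = (K * (s - a) - G s) / (G s * (s - a)) by field_simp]
  exact div_nonneg (sub_nonneg.2 (hK s hs)) (by positivity)

lemma exists_le_timeMap (h : IsSpeedField G a b) (hs₀ : s₀ ∈ Ioo a b) {t : ℝ} (ht : 0 ≤ t) :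
    ∃ s ∈ Ioo a b, t ≤ timeMap G s₀ s := by
  obtain ⟨K, hK, hb⟩ := h.bound
  have hpos : 0 < b - s₀ := sub_pos.2 hs₀.2
  have hle : (b - s₀) * Real.exp (-(K * t)) ≤ b - s₀ :=
    mul_le_of_le_one_right hpos.le (Real.exp_le_one_iff.2 (by nlinarith))
  have hlt : 0 < (b - s₀) * Real.exp (-(K * t)) := by positivity
  have hs : b - (b - s₀) * Real.exp (-(K * t)) ∈ Ioo a b := ⟨by linarith [hs₀.1], by linarith⟩
  have hmono := h.monotoneOn_timeMap_add_log hs₀ (fun s hs => (hb s hs).2) hs₀ hs (by linarith)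
  simp only [timeMap_self, sub_sub_cancel,
    Real.log_mul hpos.ne' (Real.exp_pos _).ne', Real.log_exp] at hmono
  exact ⟨_, hs, by nlinarith⟩

lemma exists_timeMap_le (h : IsSpeedField G a b) (hs₀ : s₀ ∈ Ioo a b) {t : ℝ} (ht : t ≤ 0) :
    ∃ s ∈ Ioo a b, timeMap G s₀ s ≤ t := by
  obtain ⟨K, hK, hb⟩ := h.bound
  have hpos : 0 < s₀ - a := sub_pos.2 hs₀.1
  have hle : (s₀ - a) * Real.exp (K * t) ≤ s₀ - a :=
    mul_le_of_le_one_right hpos.le (Real.exp_le_one_iff.2 (by nlinarith))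
  have hlt : 0 < (s₀ - a) * Real.exp (K * t) := by positivity
  have hs : a + (s₀ - a) * Real.exp (K * t) ∈ Ioo a b := ⟨by linarith, by linarith [hs₀.2]⟩
  have hmono := h.monotoneOn_timeMap_sub_log hs₀ (fun s hs => (hb s hs).1) hs hs₀ (by linarith)
  simp only [timeMap_self, add_sub_cancel_left,
    Real.log_mul hpos.ne' (Real.exp_pos _).ne', Real.log_exp] at hmono
  exact ⟨_, hs, by nlinarith⟩

lemma surjOn_timeMap (h : IsSpeedField G a b) (hs₀ : s₀ ∈ Ioo a b) :
    SurjOn (timeMap G s₀) (Ioo a b) univ := by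
  have hcont := continuousOn_timeMap h.continuousOn h.pos hs₀
  intro t _
  rcases le_total 0 t with ht | ht
  · obtain ⟨s, hs, hst⟩ := h.exists_le_timeMap hs₀ ht
    exact isPreconnected_Ioo.intermediate_value hs₀ hs hcont ⟨(timeMap_self G s₀).trans_le ht, hst⟩
  · obtain ⟨s, hs, hst⟩ := h.exists_timeMap_le hs₀ ht
    exact isPreconnected_Ioo.intermediate_value hs hs₀ hcont
      ⟨hst, ht.trans_eq (timeMap_self G s₀).symm⟩

/-- The time map as an order isomorphism, which makes its inverse available. -/
noncomputable def timeMapIso (h : IsSpeedField G a b) (hs₀ : s₀ ∈ Ioo a b) : Ioo a b ≃o ℝ :=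
  StrictMono.orderIsoOfSurjective (fun s => timeMap G s₀ s)
    (fun s r hsr => strictMonoOn_timeMap h.continuousOn h.pos hs₀ s.2 r.2 hsr)
    fun t => by simpa using h.surjOn_timeMap hs₀ (mem_univ t)

/-- The solution of `v' = G(v)`, `v(0) = s₀`, encoded as the inverse of the time map. -/
noncomputable def flow (h : IsSpeedField G a b) (hs₀ : s₀ ∈ Ioo a b) (z : ℝ) : ℝ :=
  (h.timeMapIso hs₀).symm z

lemma flow_mem (h : IsSpeedField G a b) (hs₀ : s₀ ∈ Ioo a b) (z : ℝ) : h.flow hs₀ z ∈ Ioo a b :=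
  ((h.timeMapIso hs₀).symm z).2

lemma timeMap_flow (h : IsSpeedField G a b) (hs₀ : s₀ ∈ Ioo a b) (z : ℝ) :
    timeMap G s₀ (h.flow hs₀ z) = z :=
  (h.timeMapIso hs₀).apply_symm_apply z

lemma flow_timeMap (h : IsSpeedField G a b) (hs₀ : s₀ ∈ Ioo a b) {s : ℝ} (hs : s ∈ Ioo a b) :
    h.flow hs₀ (timeMap G s₀ s) = s :=
  congrArg Subtype.val ((h.timeMapIso hs₀).symm_apply_apply ⟨s, hs⟩)

lemma flow_zero (h : IsSpeedField G a b) (hs₀ : s₀ ∈ Ioo a b) : h.flow hs₀ 0 = s₀ := by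
  simpa only [timeMap_self] using h.flow_timeMap hs₀ hs₀

lemma strictMono_flow (h : IsSpeedField G a b) (hs₀ : s₀ ∈ Ioo a b) : StrictMono (h.flow hs₀) :=
  (h.timeMapIso hs₀).symm.strictMono

lemma continuous_flow (h : IsSpeedField G a b) (hs₀ : s₀ ∈ Ioo a b) : Continuous (h.flow hs₀) :=
  continuous_subtype_val.comp (h.timeMapIso hs₀).symm.continuous

lemma hasDerivAt_flow (h : IsSpeedField G a b) (hs₀ : s₀ ∈ Ioo a b) (z : ℝ) :
    HasDerivAt (h.flow hs₀) (G (h.flow hs₀ z)) z := by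
  have hd := HasDerivAt.of_local_left_inverse (h.continuous_flow hs₀).continuousAt
    (hasDerivAt_timeMap h.continuousOn h.pos hs₀ (h.flow_mem hs₀ z))
    (inv_ne_zero (h.pos _ (h.flow_mem hs₀ z)).ne') (Eventually.of_forall (h.timeMap_flow hs₀))
  rwa [inv_inv] at hd

lemma tendsto_flow_atBot (h : IsSpeedField G a b) (hs₀ : s₀ ∈ Ioo a b) :
    Tendsto (h.flow hs₀) atBot (𝓝 a) :=
  tendsto_nhds_of_tendsto_nhdsWithin ((tendsto_Ioo_atBot (.of_dense a)).1
    (h.timeMapIso hs₀).symm.tendsto_atBot)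

lemma tendsto_flow_atTop (h : IsSpeedField G a b) (hs₀ : s₀ ∈ Ioo a b) :
    Tendsto (h.flow hs₀) atTop (𝓝 b) :=
  tendsto_nhds_of_tendsto_nhdsWithin ((tendsto_Ioo_atTop (.of_dense b)).1
    (h.timeMapIso hs₀).symm.tendsto_atTop)

lemma eq_flow (h : IsSpeedField G a b) {W : ℝ → ℝ} (hW : ∀ z, W z ∈ Ioo a b)
    (hd : ∀ z, HasDerivAt W (G (W z)) z) {z₀ : ℝ} (hs₀ : W z₀ ∈ Ioo a b) (z : ℝ) :
    W z = h.flow hs₀ (z - z₀) := by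
  have htime := timeMap_sub_timeMap_comp h.continuousOn h.pos hs₀ isOpen_univ convex_univ
    (fun z _ => hW z) (fun z _ => hd z) (mem_univ z) (mem_univ z₀)
  rw [timeMap_self, sub_zero] at htime
  rw [← htime, h.flow_timeMap hs₀ (hW z)]

end IsSpeedField

/-! ### Comparison and existence for backward scalar equations -/

section BackwardEquations

variable {f y u y' u' Φ : ℝ → ℝ} {a b B δ : ℝ}

lemma nonpos_of_hasDerivAt_nonneg_of_pos {w w' : ℝ → ℝ} (hw : ContinuousOn w (Icc a b))
    (hd : ∀ x ∈ Ioo a b, HasDerivAt w (w' x) x) (hw' : ∀ x ∈ Ioo a b, 0 < w x → 0 ≤ w' x)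
    (hb : w b ≤ 0) {x : ℝ} (hx : x ∈ Icc a b) : w x ≤ 0 := by
  by_contra! hpos
  have hsub : Icc x b ⊆ Icc a b := Icc_subset_Icc_left hx.1
  have hc : IsCompact (Icc x b ∩ w ⁻¹' Iic 0) :=
    isCompact_Icc.of_isClosed_subset
      ((hw.mono hsub).preimage_isClosed_of_isClosed isClosed_Icc isClosed_Iic) inter_subset_left
  obtain ⟨t, ⟨⟨hxt, htb⟩, ht⟩, hmin⟩ := hc.exists_isLeast ⟨b, right_mem_Icc.2 hx.2, hb⟩
  have hmem : ∀ s ∈ interior (Icc x t), s ∈ Ioo a b ∧ 0 < w s := fun s hs => by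
    rw [interior_Icc] at hs
    refine ⟨⟨hx.1.trans_lt hs.1, hs.2.trans_le htb⟩, ?_⟩
    by_contra! hsw
    exact (hmin ⟨⟨hs.1.le, hs.2.le.trans htb⟩, hsw⟩).not_gt hs.2
  have hmono : MonotoneOn w (Icc x t) :=
    monotoneOn_of_hasDerivWithinAt_nonneg (convex_Icc x t)
      (hw.mono ((Icc_subset_Icc_right htb).trans hsub))
      (fun s hs => (hd s (hmem s hs).1).hasDerivWithinAt)
      fun s hs => hw' s (hmem s hs).1 (hmem s hs).2
  exact (hpos.trans_le (hmono (left_mem_Icc.2 hxt) (right_mem_Icc.2 hxt) hxt)).not_ge ht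

lemma sub_le_mul_sub_of_hasDerivAt (hδ : 0 ≤ δ) (hy : ContinuousOn y (Icc a b))
    (hu : ContinuousOn u (Icc a b)) (hdy : ∀ x ∈ Ioo a b, HasDerivAt y (y' x) x)
    (hdu : ∀ x ∈ Ioo a b, HasDerivAt u (u' x) x)
    (hle : ∀ x ∈ Ioo a b, u x < y x → u' x ≤ y' x + δ) (hb : y b ≤ u b)
    {x : ℝ} (hx : x ∈ Icc a b) : y x - u x ≤ δ * (b - x) := by
  refine sub_nonpos.1 (nonpos_of_hasDerivAt_nonneg_of_pos
    (w := fun x => y x - u x - δ * (b - x)) (by fun_prop)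
    (fun x hx => ((hdy x hx).sub (hdu x hx)).sub (((hasDerivAt_id x).const_sub b).const_mul δ))
    (fun x hx hpos => ?_) (by simpa using hb) hx)
  have hδx : 0 ≤ δ * (b - x) := mul_nonneg hδ (sub_nonneg.2 hx.2.le)
  linarith [hle x hx (by linarith)]

lemma le_of_hasDerivAt_le (hy : ContinuousOn y (Icc a b)) (hu : ContinuousOn u (Icc a b))
    (hdy : ∀ x ∈ Ioo a b, HasDerivAt y (y' x) x) (hdu : ∀ x ∈ Ioo a b, HasDerivAt u (u' x) x)
    (hle : ∀ x ∈ Ioo a b, u x < y x → u' x ≤ y' x) (hb : y b ≤ u b)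
    {x : ℝ} (hx : x ∈ Icc a b) : y x ≤ u x := by
  have h := sub_le_mul_sub_of_hasDerivAt le_rfl hy hu hdy hdu
    (fun x hx hux => (hle x hx hux).trans_eq (add_zero _).symm) hb hx
  linarith

lemma lipschitzWith_integral_add (hΦ : Continuous Φ) (hB : ∀ x, ‖Φ x‖ ≤ B) (r : ℝ) :
    LipschitzWith (2 * B).toNNReal fun x => ∫ t in x..x + r, Φ t := by
  have hB0 : 0 ≤ B := (norm_nonneg _).trans (hB 0)
  have hint : ∀ s t, IntervalIntegrable Φ MeasureTheory.volume s t := hΦ.intervalIntegrable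
  have hbound : ∀ s t, ‖∫ t in s..t, Φ t‖ ≤ B * |t - s| := fun s t =>
    intervalIntegral.norm_integral_le_of_norm_le_const fun t _ => hB t
  refine LipschitzWith.of_dist_le_mul fun x z => ?_
  rw [dist_eq_norm, intervalIntegral.integral_interval_sub_interval_comm' (hint _ _) (hint _ _)
    (hint _ _), Real.dist_eq, Real.coe_toNNReal _ (by positivity)]
  have hend := hbound (z + r) (x + r)
  rw [add_sub_add_right_eq_sub] at hend
  linarith [hbound z x, norm_sub_le (∫ t in z + r..x + r, Φ t) (∫ t in z..x, Φ t)]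

lemma abs_inv_mul_integral_sub_le {r x : ℝ} (hr : 0 < r) (hΦ : Continuous Φ)
    (hδ : ∀ t ∈ Ioc x (x + r), ‖Φ t - Φ x‖ ≤ δ) : |r⁻¹ * (∫ t in x..x + r, Φ t) - Φ x| ≤ δ := by
  have hbound := intervalIntegral.norm_integral_le_of_norm_le_const (f := fun t => Φ t - Φ x)
    ((uIoc_of_le (by linarith : x ≤ x + r)).symm ▸ hδ)
  rw [intervalIntegral.integral_sub (hΦ.intervalIntegrable _ _) (by simp),
    intervalIntegral.integral_const, add_sub_cancel_left, abs_of_pos hr, smul_eq_mul,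
    Real.norm_eq_abs] at hbound
  calc |r⁻¹ * (∫ t in x..x + r, Φ t) - Φ x|
      = |r⁻¹ * ((∫ t in x..x + r, Φ t) - r * Φ x)| := by
        rw [mul_sub, inv_mul_cancel_left₀ hr.ne']
    _ = r⁻¹ * |(∫ t in x..x + r, Φ t) - r * Φ x| := by rw [abs_mul, abs_of_pos (inv_pos.2 hr)]
    _ ≤ r⁻¹ * (δ * r) := by gcongr
    _ = δ := by field_simp

lemma exists_lipschitzWith_abs_sub_le (hΦ : UniformContinuous Φ) (hB : ∀ x, ‖Φ x‖ ≤ B)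
    (hδ : 0 < δ) :
    ∃ (K : NNReal) (B' : ℝ) (Ψ : ℝ → ℝ), LipschitzWith K Ψ ∧ (∀ x, ‖Ψ x‖ ≤ B') ∧
      ∀ x, |Ψ x - Φ x| ≤ δ := by
  obtain ⟨r, hr, hrδ⟩ := Metric.uniformContinuous_iff.1 hΦ δ hδ
  have hclose : ∀ x, |(r / 2)⁻¹ * (∫ t in x..x + r / 2, Φ t) - Φ x| ≤ δ := fun x =>
    abs_inv_mul_integral_sub_le (half_pos hr) hΦ.continuous fun t ht => (hrδ (by
      rw [Real.dist_eq, abs_of_pos (by linarith [ht.1])]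
      linarith [ht.2])).le
  refine ⟨_, B + δ, fun x => (r / 2)⁻¹ * ∫ t in x..x + r / 2, Φ t,
    (lipschitzWith_smul (r / 2)⁻¹).comp (lipschitzWith_integral_add hΦ.continuous hB (r / 2)),
    fun x => ?_, hclose⟩
  rw [Real.norm_eq_abs]
  have := hB x
  rw [Real.norm_eq_abs] at this
  linarith [abs_sub_abs_le_abs_sub ((r / 2)⁻¹ * ∫ t in x..x + r / 2, Φ t) (Φ x), hclose x]

lemma exists_hasDerivAt_of_lipschitzWith {K : NNReal} (hab : a ≤ b)
    (hf : ContinuousOn f (Icc a b)) (hΦ : LipschitzWith K Φ) (hB : ∀ x, ‖Φ x‖ ≤ B) (η : ℝ) :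
    ∃ y : ℝ → ℝ, ContinuousOn y (Icc a b) ∧ y b = η ∧
      ∀ x ∈ Ioo a b, HasDerivAt y (Φ (y x) - f x) x := by
  obtain ⟨k, hk⟩ := isCompact_Icc.exists_bound_of_continuousOn hf
  have hL : 0 ≤ B + k :=
    add_nonneg ((norm_nonneg _).trans (hB a)) ((norm_nonneg _).trans (hk a (left_mem_Icc.2 hab)))
  have hPL : IsPicardLindelof (fun x y => Φ y - f x) (tmin := a) (tmax := b)
      ⟨b, right_mem_Icc.2 hab⟩ η ⟨(B + k) * (b - a), mul_nonneg hL (sub_nonneg.2 hab)⟩ 0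
      ⟨B + k, hL⟩ K :=
    { lipschitzOnWith := fun t _ => (LipschitzWith.of_dist_le_mul fun x y => by
        simpa only [dist_sub_right] using hΦ.dist_le_mul x y).lipschitzOnWith
      continuousOn := fun x _ => continuousOn_const.sub hf
      norm_le := fun t ht x _ => (norm_sub_le _ _).trans (add_le_add (hB x) (hk t ht))
      mul_max_le := by
        rw [NNReal.coe_zero, sub_zero, sub_self, max_eq_right (sub_nonneg.2 hab)]
        exact le_rfl }
  obtain ⟨y, hyb, hy⟩ := hPL.exists_eq_forall_mem_Icc_hasDerivWithinAt₀
  exact ⟨y, fun x hx => (hy x hx).continuousWithinAt, hyb, fun x hx =>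
    (hy x (Ioo_subset_Icc_self hx)).hasDerivAt (Icc_mem_nhds hx.1 hx.2)⟩

lemma exists_hasDerivAt_of_uniformCauchySeqOn {Ψ y : ℕ → ℝ → ℝ} (hΦ : UniformContinuous Φ)
    (hΨ : TendstoUniformly Ψ Φ atTop) (hy : ∀ n, ContinuousOn (y n) (Icc a b))
    (hd : ∀ n, ∀ x ∈ Ioo a b, HasDerivAt (y n) (Ψ n (y n x) - f x) x)
    (hcauchy : UniformCauchySeqOn y atTop (Icc a b)) :
    ∃ Y : ℝ → ℝ, TendstoUniformlyOn y Y atTop (Icc a b) ∧ ContinuousOn Y (Icc a b) ∧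
      ∀ x ∈ Ioo a b, HasDerivAt Y (Φ (Y x) - f x) x := by
  have hex : ∀ x, ∃ l, x ∈ Icc a b → Tendsto (fun n => y n x) atTop (𝓝 l) := fun x => by
    by_cases hx : x ∈ Icc a b
    · obtain ⟨l, hl⟩ := cauchySeq_tendsto_of_complete (hcauchy.cauchySeq hx)
      exact ⟨l, fun _ => hl⟩
    · exact ⟨0, fun h => (hx h).elim⟩
  choose Y hY using hex
  have hunif := hcauchy.tendstoUniformlyOn_of_tendsto hY
  refine ⟨Y, hunif, hunif.continuousOn (Frequently.of_forall hy), fun x hx => ?_⟩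
  refine hasDerivAt_of_tendstoUniformlyOn (g' := fun x => Φ (Y x) - f x) isOpen_Ioo
    (Metric.tendstoUniformlyOn_iff.2 fun η hη => ?_) (Eventually.of_forall hd)
    (fun x hx => hY x (Ioo_subset_Icc_self hx)) hx
  filter_upwards [Metric.tendstoUniformlyOn_iff.1 (hΦ.comp_tendstoUniformlyOn hunif) _
    (half_pos hη), Metric.tendstoUniformly_iff.1 hΨ _ (half_pos hη)] with n hΦn hΨn x hx
  rw [dist_sub_right, ← add_halves η]
  exact (dist_triangle _ (Φ (y n x)) _).trans_lt
    (add_lt_add (hΦn x (Ioo_subset_Icc_self hx)) (hΨn _))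

lemma uniformCauchySeqOn_of_monotone {Ψ y : ℕ → ℝ → ℝ} {η : ℝ} (hab : a ≤ b) (hΦ : Monotone Φ)
    (hΨ : TendstoUniformly Ψ Φ atTop) (hy : ∀ n, ContinuousOn (y n) (Icc a b))
    (hyb : ∀ n, y n b = η)
    (hd : ∀ n, ∀ x ∈ Ioo a b, HasDerivAt (y n) (Ψ n (y n x) - f x) x) :
    UniformCauchySeqOn y atTop (Icc a b) := by
  refine Metric.uniformCauchySeqOn_iff.2 fun κ hκ => ?_
  set δ : ℝ := κ / (4 * (b - a + 1)) with hδ_def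
  have hδ : 0 < δ := div_pos hκ (by linarith)
  have hδκ : 2 * δ * (b - a) < κ := by
    rw [hδ_def, show 2 * (κ / (4 * (b - a + 1))) * (b - a)
      = κ * (2 * (b - a)) / (4 * (b - a + 1)) by ring, div_lt_iff₀ (by linarith)]
    nlinarith [sub_nonneg.2 hab]
  obtain ⟨N, hN⟩ := eventually_atTop.1 (Metric.tendstoUniformly_iff.1 hΨ δ hδ)
  have hclose : ∀ n ≥ N, ∀ z, |Φ z - Ψ n z| < δ := fun n hn z => hN n hn z
  have hsub : ∀ m ≥ N, ∀ n ≥ N, ∀ x ∈ Icc a b, y m x - y n x < κ := fun m hm n hn x hx => by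
    have hcmp := sub_le_mul_sub_of_hasDerivAt (mul_pos two_pos hδ).le (hy m) (hy n) (hd m) (hd n)
      (fun x _ hlt => by
        linarith [hΦ hlt.le, abs_lt.1 (hclose m hm (y m x)), abs_lt.1 (hclose n hn (y n x))])
      (by rw [hyb, hyb]) hx
    exact hcmp.trans_lt ((mul_le_mul_of_nonneg_left (by linarith [hx.1]) (by positivity)).trans_lt
      hδκ)
  refine ⟨N, fun m hm n hn x hx => ?_⟩
  rw [Real.dist_eq, abs_lt]
  constructor <;> linarith [hsub m hm n hn x hx, hsub n hn m hm x hx]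

lemma exists_hasDerivAt_of_monotone (hab : a ≤ b) (hf : ContinuousOn f (Icc a b))
    (hmono : Monotone Φ) (hΦ : UniformContinuous Φ) (hB : ∀ x, ‖Φ x‖ ≤ B) (η : ℝ) :
    ∃ y : ℝ → ℝ, ContinuousOn y (Icc a b) ∧ y b = η ∧
      ∀ x ∈ Ioo a b, HasDerivAt y (Φ (y x) - f x) x := by
  choose K B' Ψ hlip hB' hclose using fun n : ℕ =>
    exists_lipschitzWith_abs_sub_le hΦ hB (Nat.one_div_pos_of_nat (n := n) (α := ℝ))
  have hΨ : TendstoUniformly Ψ Φ atTop := Metric.tendstoUniformly_iff.2 fun κ hκ => by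
    filter_upwards [tendsto_one_div_add_atTop_nhds_zero_nat.eventually (gt_mem_nhds hκ)]
      with n hn x
    rw [dist_comm]
    exact (hclose n x).trans_lt hn
  choose y hy hyb hd using fun n =>
    exists_hasDerivAt_of_lipschitzWith hab hf (hlip n) (hB' n) η
  obtain ⟨Y, hunif, hYc, hYd⟩ := exists_hasDerivAt_of_uniformCauchySeqOn hΦ hΨ hy hd
    (uniformCauchySeqOn_of_monotone hab hmono hΨ hy hyb hd)
  refine ⟨Y, hYc, tendsto_nhds_unique (hunif.tendsto_at (right_mem_Icc.2 hab)) ?_, hYd⟩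
  simp only [hyb, tendsto_const_nhds_iff]

end BackwardEquations

/-! ### The reduced nonlinearity -/

section reductionR

variable {ε x y : ℝ}

lemma reductionR_zero (ε : ℝ) : reductionR ε 0 = 0 := by simp [reductionR]

lemma reductionR_pos (hε : 0 < ε) (hy : 0 < y) : 0 < reductionR ε y :=
  div_pos (Real.sqrt_pos.2 (by positivity)) (by positivity)

lemma reductionR_nonneg (hε : 0 < ε) (hy : 0 ≤ y) : 0 ≤ reductionR ε y :=
  div_nonneg (Real.sqrt_nonneg _) (by positivity)

lemma reductionR_sq (hε : 0 < ε) (hy : 0 ≤ y) : reductionR ε y ^ 2 = 1 - (ε / (ε + y)) ^ 2 := by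
  rw [reductionR, div_pow, Real.sq_sqrt (by positivity)]
  field_simp
  ring

lemma reductionR_eq_sqrt (hε : 0 < ε) (hy : 0 ≤ y) :
    reductionR ε y = √(1 - (ε / (ε + y)) ^ 2) := by
  rw [← reductionR_sq hε hy, Real.sqrt_sq (reductionR_nonneg hε hy)]

lemma reductionR_lt_one (hε : 0 < ε) (hy : 0 ≤ y) : reductionR ε y < 1 := by
  have hpos : 0 < ε / (ε + y) := by positivity
  nlinarith [reductionR_sq hε hy, reductionR_nonneg hε hy]

lemma one_sub_div_le_reductionR (hε : 0 < ε) (hy : 0 ≤ y) :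
    1 - ε / (ε + y) ≤ reductionR ε y := by
  have hpos : 0 ≤ ε / (ε + y) := by positivity
  have hle : ε / (ε + y) ≤ 1 := (div_le_one (by positivity)).2 (by linarith)
  nlinarith [reductionR_sq hε hy, reductionR_nonneg hε hy]

lemma reductionR_le_sqrt (hε : 0 < ε) (hy : 0 ≤ y) : reductionR ε y ≤ √(2 / ε * y) := by
  refine Real.le_sqrt_of_sq_le ?_
  rw [reductionR, div_pow, Real.sq_sqrt (by positivity), div_mul_eq_mul_div,
    div_le_div_iff₀ (by positivity) hε]
  nlinarith [pow_nonneg hy 3, mul_nonneg hε.le (sq_nonneg y)]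

lemma reductionR_mono (hε : 0 < ε) (hx : 0 ≤ x) (hxy : x ≤ y) :
    reductionR ε x ≤ reductionR ε y := by
  have hy : 0 ≤ y := hx.trans hxy
  rw [reductionR_eq_sqrt hε hx, reductionR_eq_sqrt hε hy]
  gcongr

lemma continuousOn_reductionR (hε : 0 < ε) : ContinuousOn (reductionR ε) (Ici 0) := by
  unfold reductionR
  refine ContinuousOn.div (by fun_prop) (by fun_prop) fun y (hy : 0 ≤ y) => ?_
  positivity

lemma uniformContinuous_sqrt_one_sub_sq : UniformContinuous fun t : ℝ => √(1 - t ^ 2) := by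
  refine HasCompactSupport.uniformContinuous_of_continuous (.of_support_subset_isCompact
    (isCompact_Icc (a := -1) (b := 1)) fun t ht => abs_le.1 ?_) (by fun_prop)
  by_contra! hlt
  exact ht (Real.sqrt_eq_zero_of_nonpos (sub_nonpos.2 (one_le_sq_iff_one_le_abs t |>.2 hlt.le)))

lemma uniformContinuous_div_add_max (hε : 0 < ε) :
    UniformContinuous fun y => ε / (ε + max y 0) := by
  refine (LipschitzWith.of_dist_le' (K := 1 / ε) fun x y => ?_).uniformContinuous
  have hx : ε ≤ ε + max x 0 := le_add_of_nonneg_right (le_max_right _ _)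
  have hy : ε ≤ ε + max y 0 := le_add_of_nonneg_right (le_max_right _ _)
  rw [Real.dist_eq, Real.dist_eq, div_sub_div _ _ (by positivity) (by positivity), abs_div,
    ← mul_comm ε, ← mul_sub, add_sub_add_left_eq_sub, abs_mul, abs_mul, abs_of_pos hε,
    abs_of_pos (hε.trans_le hx), abs_of_pos (hε.trans_le hy), abs_sub_comm]
  calc ε * |max x 0 - max y 0| / ((ε + max x 0) * (ε + max y 0))
      ≤ ε * |x - y| / (ε * ε) := by
        have habs := abs_max_sub_max_le_abs x y 0
        gcongr ε * ?_ / (?_ * ?_)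
    _ = 1 / ε * |x - y| := by field_simp

lemma uniformContinuous_reductionR_max (hε : 0 < ε) :
    UniformContinuous fun y => reductionR ε (max y 0) := by
  simp only [reductionR_eq_sqrt hε (le_max_right _ _)]
  exact uniformContinuous_sqrt_one_sub_sq.comp (uniformContinuous_div_add_max hε)

lemma reductionR_sqrt_sub (ε : ℝ) (hx : 0 ≤ x) :
    reductionR ε (√(ε ^ 2 + x ^ 2) - ε) = x / √(ε ^ 2 + x ^ 2) := by
  have hs : √(ε ^ 2 + x ^ 2) ^ 2 = ε ^ 2 + x ^ 2 := Real.sq_sqrt (by positivity)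
  rw [reductionR, show (√(ε ^ 2 + x ^ 2) - ε) * (2 * ε + (√(ε ^ 2 + x ^ 2) - ε)) = x ^ 2 by
    linear_combination hs, Real.sqrt_sq hx, add_sub_cancel]

end reductionR

/-! ### The primitive and its tangent through the origin -/

section primitive

variable {f : ℝ → ℝ} {a b m s v : ℝ}

lemma intervalIntegrable_of_mem_Icc (hf : ContinuousOn f (Icc 0 1)) (ha : a ∈ Icc (0 : ℝ) 1)
    (hb : b ∈ Icc (0 : ℝ) 1) : IntervalIntegrable f MeasureTheory.volume a b :=
  (hf.mono (ordConnected_Icc.uIcc_subset ha hb)).intervalIntegrable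

lemma primitive_zero (f : ℝ → ℝ) : primitive f 0 = 0 :=
  intervalIntegral.integral_same

lemma hasDerivAt_primitive (hf : ContinuousOn f (Icc 0 1)) (hv : v ∈ Ioo (0 : ℝ) 1) :
    HasDerivAt (primitive f) (f v) v :=
  intervalIntegral.integral_hasDerivAt_right
    (intervalIntegrable_of_mem_Icc hf (left_mem_Icc.2 zero_le_one) (Ioo_subset_Icc_self hv))
    ((hf.mono Ioo_subset_Icc_self).stronglyMeasurableAtFilter isOpen_Ioo v hv)
    (hf.continuousAt (Icc_mem_nhds hv.1 hv.2))

lemma continuousOn_primitive (hf : ContinuousOn f (Icc 0 1)) :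
    ContinuousOn (primitive f) (Icc 0 1) := by
  rw [← uIcc_of_le zero_le_one] at hf ⊢
  exact intervalIntegral.continuousOn_primitive_interval hf.integrableOn_uIcc

lemma deriv_primitive (hf : ContinuousOn f (Icc 0 1)) (ha : 0 ≤ a) (hb : b ≤ 1) :
    EqOn f (deriv (primitive f)) (interior (Icc a b)) := fun _ hs => by
  rw [interior_Icc] at hs
  exact (hasDerivAt_primitive hf ⟨ha.trans_lt hs.1, hs.2.trans_le hb⟩).deriv.symm

lemma strictConvexOn_primitive (hf : ContinuousOn f (Icc 0 1)) (ha : 0 ≤ a) (hb : b ≤ 1)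
    (h : StrictMonoOn f (Icc a b)) : StrictConvexOn ℝ (Icc a b) (primitive f) :=
  ((h.mono interior_subset).congr (deriv_primitive hf ha hb)).strictConvexOn_of_deriv
    (convex_Icc a b) ((continuousOn_primitive hf).mono (Icc_subset_Icc ha hb))

lemma strictConcaveOn_primitive (hf : ContinuousOn f (Icc 0 1)) (ha : 0 ≤ a) (hb : b ≤ 1)
    (h : StrictAntiOn f (Icc a b)) : StrictConcaveOn ℝ (Icc a b) (primitive f) :=
  ((h.mono interior_subset).congr (deriv_primitive hf ha hb)).strictConcaveOn_of_deriv
    (convex_Icc a b) ((continuousOn_primitive hf).mono (Icc_subset_Icc ha hb))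

lemma primitive_lt_tangent (hf : ContinuousOn f (Icc 0 1)) (ha : 0 ≤ a) (hb : b ≤ 1)
    (h : StrictAntiOn f (Icc a b)) (hv : v ∈ Ioo (0 : ℝ) 1) (hvI : v ∈ Icc a b)
    (hs : s ∈ Icc a b) (hsv : s ≠ v) : primitive f s < primitive f v + f v * (s - v) := by
  have hconc := strictConcaveOn_primitive hf ha hb h
  rcases hsv.lt_or_gt with hlt | hlt
  · have hslope := hconc.lt_slope_of_hasDerivAt hs hvI hlt (hasDerivAt_primitive hf hv)
    rw [slope_def_field, lt_div_iff₀ (sub_pos.2 hlt)] at hslope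
    linarith
  · have hslope := hconc.slope_lt_of_hasDerivAt hvI hs hlt (hasDerivAt_primitive hf hv)
    rw [slope_def_field, div_lt_iff₀ (sub_pos.2 hlt)] at hslope
    linarith

lemma primitive_lt_mul_right (hf : ContinuousOn f (Icc 0 1)) (hm : m ∈ Ioo (0 : ℝ) 1)
    (h : StrictMonoOn f (Icc 0 m)) : primitive f m < f m * m := by
  have hslope := (strictConvexOn_primitive hf le_rfl hm.2.le h).slope_lt_of_hasDerivAt
    (left_mem_Icc.2 hm.1.le) (right_mem_Icc.2 hm.1.le) hm.1 (hasDerivAt_primitive hf hm)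
  rwa [slope_def_field, primitive_zero, sub_zero, sub_zero, div_lt_iff₀ hm.1] at hslope

lemma mul_primitive_lt (hf : ContinuousOn f (Icc 0 1)) (hm : m ≤ 1)
    (h : StrictMonoOn f (Icc 0 m)) (hs : s ∈ Ioo 0 m) :
    m * primitive f s < s * primitive f m := by
  have hm0 : 0 < m := hs.1.trans hs.2
  have hsec := (strictConvexOn_primitive hf le_rfl hm h).secant_strict_mono
    (left_mem_Icc.2 hm0.le) (Ioo_subset_Icc_self hs) (right_mem_Icc.2 hm0.le) hs.1.ne' hm0.ne' hs.2
  simp only [primitive_zero, sub_zero] at hsec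
  rw [div_lt_div_iff₀ hs.1 hm0] at hsec
  linarith

end primitive

section UnimodalShape

variable {f : ℝ → ℝ} {a b m p u s : ℝ}

lemma strictMonoOn_of_forall_not_isLocalMax (hf : ContinuousOn f (Icc a b))
    (ha : ∀ s ∈ Ioc a b, f a < f s) (hmax : ∀ t ∈ Ioo a b, ¬ IsLocalMax f t) :
    StrictMonoOn f (Icc a b) := by
  intro x hx y hy hxy
  by_contra! hle
  rcases hx.1.eq_or_lt with rfl | hax
  · exact (ha y ⟨hxy, hy.2⟩).not_ge hle
  have hno : ∀ r ∈ Ioo a y, ¬ IsMaxOn f (Icc a y) r := fun r hr hrmax =>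
    hmax r ⟨hr.1, hr.2.trans_le hy.2⟩ (hrmax.isLocalMax (Icc_mem_nhds hr.1 hr.2))
  obtain ⟨t, ht, htmax⟩ := isCompact_Icc.exists_isMaxOn (nonempty_Icc.2 hy.1)
    (hf.mono (Icc_subset_Icc_right hy.2))
  rcases ht.2.eq_or_lt with rfl | hty
  · exact hno x ⟨hax, hxy⟩ fun r hr => (htmax hr).trans hle
  rcases ht.1.eq_or_lt with rfl | hat
  · exact (ha x ⟨hax, hx.2⟩).not_ge (htmax ⟨hax.le, hxy.le⟩)
  · exact hno t ⟨hat, hty⟩ htmax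

lemma strictAntiOn_of_forall_not_isLocalMax (hf : ContinuousOn f (Icc a b))
    (hb : ∀ s ∈ Ico a b, f b < f s) (hmax : ∀ t ∈ Ioo a b, ¬ IsLocalMax f t) :
    StrictAntiOn f (Icc a b) := by
  have hmono : StrictMonoOn (fun s => f (-s)) (Icc (-b) (-a)) := by
    refine strictMonoOn_of_forall_not_isLocalMax
      (hf.comp continuousOn_neg fun s hs => ⟨le_neg_of_le_neg hs.2, neg_le_of_neg_le hs.1⟩)
      (fun s hs => ?_) fun t ht hloc => ?_
    · rw [neg_neg]
      exact hb _ ⟨le_neg_of_le_neg hs.2, neg_lt_of_neg_lt hs.1⟩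
    · have hcomp := IsLocalMax.comp_continuous (g := Neg.neg) (b := -t)
        (by rwa [neg_neg]) continuous_neg.continuousAt
      simp only [Function.comp_def, neg_neg] at hcomp
      exact hmax (-t) ⟨lt_neg_of_lt_neg ht.2, neg_lt_of_neg_lt ht.1⟩ hcomp
  intro x hx y hy hxy
  simpa only [neg_neg] using hmono ⟨neg_le_neg hy.2, neg_le_neg hy.1⟩
    ⟨neg_le_neg hx.2, neg_le_neg hx.1⟩ (neg_lt_neg hxy)

/-- `f` is positive on `(0, 1)` and decreases on `[m, 1]`, and the line through the origin with
slope `f p` lies above the graph of the primitive of `f` and touches it at `p ∈ (m, 1)`. This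
is the point called `v₊` in the limit problem. -/
structure IsTangency (f : ℝ → ℝ) (m p : ℝ) : Prop where
  continuousOn : ContinuousOn f (Icc 0 1)
  pos : ∀ s ∈ Ioo (0 : ℝ) 1, 0 < f s
  m_pos : 0 < m
  m_lt : m < p
  lt_one : p < 1
  strictAntiOn : StrictAntiOn f (Icc m 1)
  primitive_eq : primitive f p = f p * p
  primitive_lt : ∀ s ∈ Ioo 0 p, primitive f s < f p * s

lemma exists_primitive_eq (hf : ContinuousOn f (Icc 0 1)) (hpos : ∀ s ∈ Ioo (0 : ℝ) 1, 0 < f s)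
    (hone : f 1 = 0) (hm : m ∈ Ioo (0 : ℝ) 1) (hmono : StrictMonoOn f (Icc 0 m)) :
    ∃ p ∈ Ioo m 1, primitive f p = f p * p := by
  have hcont : ContinuousOn (fun v => primitive f v - f v * v) (Icc m 1) :=
    ((continuousOn_primitive hf).sub (hf.mul continuousOn_id)).mono
      (Icc_subset_Icc_left hm.1.le)
  have hF1 : 0 < primitive f 1 :=
    intervalIntegral.intervalIntegral_pos_of_pos_on (intervalIntegrable_of_mem_Icc hf
      (left_mem_Icc.2 zero_le_one) (right_mem_Icc.2 zero_le_one)) hpos zero_lt_one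
  obtain ⟨p, hp, hroot⟩ := intermediate_value_Ioo hm.2.le hcont
    ⟨sub_neg.2 (primitive_lt_mul_right hf hm hmono), by simpa [hone] using hF1⟩
  exact ⟨p, hp, sub_eq_zero.1 hroot⟩

lemma primitive_lt_of_primitive_eq (hf : ContinuousOn f (Icc 0 1)) (hm : m ∈ Ioo (0 : ℝ) 1)
    (hmono : StrictMonoOn f (Icc 0 m)) (hanti : StrictAntiOn f (Icc m 1)) (hp : p ∈ Ioo m 1)
    (hroot : primitive f p = f p * p) (hs : s ∈ Ioo 0 p) : primitive f s < f p * s := by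
  have hright : ∀ v ∈ Ico m p, primitive f v < f p * v := fun v hv => by
    have htan := primitive_lt_tangent hf hm.1.le le_rfl hanti ⟨hm.1.trans hp.1, hp.2⟩
      (Ioo_subset_Icc_self hp) ⟨hv.1, hv.2.le.trans hp.2.le⟩ hv.2.ne
    linarith
  rcases lt_or_ge s m with hsm | hms
  · have hstar := mul_primitive_lt hf hm.2.le hmono ⟨hs.1, hsm⟩
    have hF := mul_lt_mul_of_pos_left (hright m ⟨le_rfl, hp.1⟩) hs.1
    exact lt_of_mul_lt_mul_left (by linarith) hm.1.le
  · exact hright s ⟨hms, hs.2⟩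

lemma exists_isTangency (hH : ConditionH f) (hA : IsTypeA f)
    (hmax : ∃! m : ℝ, m ∈ Ioo (0 : ℝ) 1 ∧ IsLocalMax f m) : ∃ m p, IsTangency f m p := by
  obtain ⟨m, ⟨hm, -⟩, huniq⟩ := hmax
  have hf := hH.continuousOn
  have hmono : StrictMonoOn f (Icc 0 m) := strictMonoOn_of_forall_not_isLocalMax
    (hf.mono (Icc_subset_Icc_right hm.2.le))
    (fun s hs => hH.zero.trans_lt (hA s ⟨hs.1, hs.2.trans_lt hm.2⟩))
    fun t ht hloc => ht.2.ne (huniq t ⟨⟨ht.1, ht.2.trans hm.2⟩, hloc⟩)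
  have hanti : StrictAntiOn f (Icc m 1) := strictAntiOn_of_forall_not_isLocalMax
    (hf.mono (Icc_subset_Icc_left hm.1.le))
    (fun s hs => hH.one.trans_lt (hA s ⟨hm.1.trans_le hs.1, hs.2⟩))
    fun t ht hloc => ht.1.ne' (huniq t ⟨⟨hm.1.trans ht.1, ht.2⟩, hloc⟩)
  obtain ⟨p, hp, hroot⟩ := exists_primitive_eq hf hA hH.one hm hmono
  exact ⟨m, p, hf, hA, hm.1, hp.1, hp.2, hanti, hroot, fun s hs =>
    primitive_lt_of_primitive_eq hf hm hmono hanti hp hroot hs⟩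

namespace IsTangency

lemma p_pos (h : IsTangency f m p) : 0 < p := h.m_pos.trans h.m_lt

lemma p_mem (h : IsTangency f m p) : p ∈ Ioo (0 : ℝ) 1 := ⟨h.p_pos, h.lt_one⟩

lemma f_p_pos (h : IsTangency f m p) : 0 < f p := h.pos p h.p_mem

lemma primitive_lt_of_gt (h : IsTangency f m p) (hs : s ∈ Ioc p 1) : primitive f s < f p * s := by
  have htan := primitive_lt_tangent h.continuousOn h.m_pos.le le_rfl h.strictAntiOn h.p_mem
    ⟨h.m_lt.le, h.lt_one.le⟩ ⟨h.m_lt.le.trans hs.1.le, hs.2⟩ hs.1.ne'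
  linarith [h.primitive_eq]

lemma primitive_le (h : IsTangency f m p) (hs : s ∈ Icc (0 : ℝ) 1) : primitive f s ≤ f p * s := by
  rcases hs.1.eq_or_lt with rfl | hs0
  · rw [primitive_zero, mul_zero]
  rcases lt_trichotomy s p with hsp | rfl | hps
  · exact (h.primitive_lt s ⟨hs0, hsp⟩).le
  · exact h.primitive_eq.le
  · exact (h.primitive_lt_of_gt ⟨hps, hs.2⟩).le

lemma isGreatest (h : IsTangency f m p) :
    IsGreatest {u ∈ Icc (0 : ℝ) 1 | primitive f u = u * f u} p := by
  refine ⟨⟨Ioo_subset_Icc_self h.p_mem, h.primitive_eq.trans (mul_comm _ _)⟩, ?_⟩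
  rintro u ⟨hu, hroot⟩
  by_contra! hpu
  have hmp : m < p := h.m_lt
  obtain ⟨c, hc, hslope⟩ := exists_hasDerivAt_eq_slope (primitive f) f hpu
    ((continuousOn_primitive h.continuousOn).mono (Icc_subset_Icc h.p_pos.le hu.2))
    fun x hx => hasDerivAt_primitive h.continuousOn ⟨h.p_pos.trans hx.1, hx.2.trans_le hu.2⟩
  have huc : f u < f c := h.strictAntiOn ⟨by linarith [hc.1], by linarith [hc.2, hu.2]⟩
    ⟨by linarith, hu.2⟩ hc.2
  have hup : f u < f p := h.strictAntiOn ⟨hmp.le, h.lt_one.le⟩ ⟨by linarith, hu.2⟩ hpu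
  rw [hslope, lt_div_iff₀ (sub_pos.2 hpu), hroot, h.primitive_eq] at huc
  nlinarith [h.p_pos]

end IsTangency

end UnimodalShape

/-! ### Terminal solutions of the first-order reduction and the critical speed -/

section TerminalSolutions

variable {f y y₁ y₂ u u' q : ℝ → ℝ} {ε c c₁ c₂ a b k q' v L η : ℝ}

/-- `y` solves the first-order reduction `y' = c R_ε(y) - f(v)` on `[0, 1]`, is positive inside and
vanishes at `1`. The value at `0` is left free: `c` is admissible when it vanishes. -/
structure IsTerminalSolution (f : ℝ → ℝ) (ε c : ℝ) (y : ℝ → ℝ) : Prop where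
  continuousOn : ContinuousOn y (Icc 0 1)
  one : y 1 = 0
  pos : ∀ v ∈ Ioo (0 : ℝ) 1, 0 < y v
  hasDerivAt : ∀ v ∈ Ioo (0 : ℝ) 1, HasDerivAt y (c * reductionR ε (y v) - f v) v

namespace IsTerminalSolution

lemma nonneg (h : IsTerminalSolution f ε c y) (hv : v ∈ Icc (0 : ℝ) 1) : 0 ≤ y v := by
  rw [← closure_Ioo zero_ne_one] at hv
  exact ContinuousWithinAt.closure_le hv continuousWithinAt_const
    ((h.continuousOn.mono (closure_Ioo zero_ne_one).subset v hv).mono subset_closure)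
    fun v hv => (h.pos v hv).le

lemma le_of_supersolution (h : IsTerminalSolution f ε c y) (hε : 0 < ε) (hc : 0 ≤ c)
    (ha : 0 ≤ a) (hb : b ≤ 1) (hu : ContinuousOn u (Icc a b)) (hu0 : ∀ x ∈ Ioo a b, 0 ≤ u x)
    (hdu : ∀ x ∈ Ioo a b, HasDerivAt u (u' x) x)
    (hle : ∀ x ∈ Ioo a b, u' x ≤ c * reductionR ε (u x) - f x) (hub : y b ≤ u b)
    (hv : v ∈ Icc a b) : y v ≤ u v := by
  refine le_of_hasDerivAt_le (h.continuousOn.mono (Icc_subset_Icc ha hb)) hu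
    (fun x hx => h.hasDerivAt x ⟨ha.trans_lt hx.1, hx.2.trans_le hb⟩) hdu (fun x hx hlt => ?_)
    hub hv
  have hR := mul_le_mul_of_nonneg_left (reductionR_mono hε (hu0 x hx) hlt.le) hc
  linarith [hle x hx]

lemma le_of_speed_le (h₁ : IsTerminalSolution f ε c₁ y₁) (h₂ : IsTerminalSolution f ε c₂ y₂)
    (hε : 0 < ε) (hc₁ : 0 ≤ c₁) (hc : c₁ ≤ c₂) (hv : v ∈ Icc (0 : ℝ) 1) : y₂ v ≤ y₁ v :=
  h₂.le_of_supersolution hε (hc₁.trans hc) le_rfl le_rfl h₁.continuousOn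
    (fun x hx => (h₁.pos x hx).le) h₁.hasDerivAt
    (fun x hx => sub_le_sub_right
      (mul_le_mul_of_nonneg_right hc (reductionR_nonneg hε (h₁.pos x hx).le)) _)
    (by rw [h₁.one, h₂.one]) hv

lemma sub_le_speed_sub_mul (h₁ : IsTerminalSolution f ε c₁ y₁)
    (h₂ : IsTerminalSolution f ε c₂ y₂) (hε : 0 < ε) (hc₁ : 0 ≤ c₁) (hc : c₁ ≤ c₂)
    (hv : v ∈ Icc (0 : ℝ) 1) : y₁ v - y₂ v ≤ (c₂ - c₁) * (1 - v) := by
  refine sub_le_mul_sub_of_hasDerivAt (sub_nonneg.2 hc) h₁.continuousOn h₂.continuousOn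
    h₁.hasDerivAt h₂.hasDerivAt (fun x hx hlt => ?_) (by rw [h₁.one, h₂.one]) hv
  have hR := mul_le_mul_of_nonneg_left (reductionR_mono hε (h₂.pos x hx).le hlt.le) hc₁
  have hR1 := mul_le_mul_of_nonneg_left (reductionR_lt_one hε (h₂.pos x hx).le).le
    (sub_nonneg.2 hc)
  linarith

lemma antitoneOn_add_primitive_sub (h : IsTerminalSolution f ε c y)
    (hf : ContinuousOn f (Icc 0 1)) (hε : 0 < ε) (hc : 0 ≤ c) :
    AntitoneOn (fun v => y v + primitive f v - c * v) (Icc 0 1) := by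
  refine antitoneOn_of_hasDerivWithinAt_nonpos (convex_Icc 0 1)
    (f' := fun v => c * reductionR ε (y v) - f v + f v - c * 1)
    ((h.continuousOn.add (continuousOn_primitive hf)).sub (by fun_prop)) (fun v hv => ?_)
    fun v hv => ?_
  · rw [interior_Icc] at hv
    exact (((h.hasDerivAt v hv).add (hasDerivAt_primitive hf hv)).sub
      ((hasDerivAt_id v).const_mul c)).hasDerivWithinAt
  · rw [interior_Icc] at hv
    have hR := mul_le_mul_of_nonneg_left (reductionR_lt_one hε (h.pos v hv).le).le hc
    linarith

end IsTerminalSolution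

lemma nonneg_of_hasDerivAt_max (hpos : ∀ s ∈ Ioo (0 : ℝ) 1, 0 < f s)
    (hy : ContinuousOn y (Icc 0 1)) (hy1 : y 1 = 0)
    (hd : ∀ x ∈ Ioo (0 : ℝ) 1, HasDerivAt y (c * reductionR ε (max (y x) 0) - f x) x)
    (hv : v ∈ Icc (0 : ℝ) 1) : 0 ≤ y v := by
  refine neg_nonpos.1 (nonpos_of_hasDerivAt_nonneg_of_pos hy.neg (fun x hx => (hd x hx).neg)
    (fun x hx hlt => ?_) (by rw [Pi.neg_apply, hy1, neg_zero]) hv)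
  rw [max_eq_right (neg_pos.1 hlt).le, reductionR_zero]
  linarith [hpos x hx]

lemma exists_isTerminalSolution (hε : 0 < ε) (hc : 0 ≤ c) (hf : ContinuousOn f (Icc 0 1))
    (hpos : ∀ s ∈ Ioo (0 : ℝ) 1, 0 < f s) : ∃ y, IsTerminalSolution f ε c y := by
  have hmax0 : ∀ x : ℝ, 0 ≤ max x 0 := fun x => le_max_right x 0
  have hbound : ∀ x, ‖c * reductionR ε (max x 0)‖ ≤ c := fun x => by
    rw [Real.norm_of_nonneg (mul_nonneg hc (reductionR_nonneg hε (hmax0 x)))]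
    exact mul_le_of_le_one_right hc (reductionR_lt_one hε (hmax0 x)).le
  obtain ⟨y, hy, hy1, hd⟩ := exists_hasDerivAt_of_monotone zero_le_one hf
    (fun x₁ x₂ hx => mul_le_mul_of_nonneg_left
      (reductionR_mono hε (hmax0 x₁) (max_le_max_right 0 hx)) hc)
    ((uniformContinuous_reductionR_max hε).const_mul' c) hbound 0
  have hnn : ∀ x ∈ Icc (0 : ℝ) 1, 0 ≤ y x := fun x hx => nonneg_of_hasDerivAt_max hpos hy hy1 hd hx
  have hy_pos : ∀ x ∈ Ioo (0 : ℝ) 1, 0 < y x := fun x hx => by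
    refine (hnn x (Ioo_subset_Icc_self hx)).lt_of_ne fun h0 => ?_
    have hmin : IsLocalMin y x := by
      filter_upwards [Icc_mem_nhds hx.1 hx.2] with t ht
      rw [← h0]
      exact hnn t ht
    have hd0 := hmin.hasDerivAt_eq_zero (hd x hx)
    rw [← h0, max_self, reductionR_zero] at hd0
    linarith [hpos x hx]
  refine ⟨y, hy, hy1, hy_pos, fun x hx => ?_⟩
  simpa only [max_eq_left (hy_pos x hx).le] using hd x hx

lemma isAdmissibleSpeed_iff (hpos : ∀ s ∈ Ioo (0 : ℝ) 1, 0 < f s) (hε : 0 < ε) :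
    IsAdmissibleSpeed f ε c ↔ 0 ≤ c ∧ ∃ y, IsTerminalSolution f ε c y ∧ y 0 = 0 := by
  constructor
  · rintro ⟨y, hy, h0, h1, hd⟩
    refine ⟨?_, y, ⟨hy, h1, fun v hv => (hd v hv).1, fun v hv => (hd v hv).2⟩, h0⟩
    by_contra! hc
    have hanti : StrictAntiOn y (Icc 0 1) := by
      refine strictAntiOn_of_hasDerivWithinAt_neg (convex_Icc 0 1) hy
        (fun v hv => (hd v (by rwa [interior_Icc] at hv)).2.hasDerivWithinAt) fun v hv => ?_
      rw [interior_Icc] at hv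
      have hR := mul_nonpos_of_nonpos_of_nonneg hc.le (reductionR_nonneg hε (hd v hv).1.le)
      linarith [hpos v hv]
    have hlt := hanti (left_mem_Icc.2 zero_le_one) (right_mem_Icc.2 zero_le_one) zero_lt_one
    exact hlt.ne (h1.trans h0.symm)
  · rintro ⟨-, y, hy, h0⟩
    exact ⟨y, hy.continuousOn, h0, hy.one, fun v hv => ⟨hy.pos v hv, hy.hasDerivAt v hv⟩⟩

lemma IsAdmissibleSpeed.primitive_lt (h : IsAdmissibleSpeed f ε c)
    (hf : ContinuousOn f (Icc 0 1)) (hpos : ∀ s ∈ Ioo (0 : ℝ) 1, 0 < f s) (hε : 0 < ε)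
    (hv : v ∈ Ioo (0 : ℝ) 1) : primitive f v < c * v := by
  obtain ⟨hc, y, hy, hy0⟩ := (isAdmissibleSpeed_iff hpos hε).1 h
  have hle := hy.antitoneOn_add_primitive_sub hf hε hc (left_mem_Icc.2 zero_le_one)
    (Ioo_subset_Icc_self hv) hv.1.le
  simp only [hy0, primitive_zero, mul_zero, add_zero, sub_zero] at hle
  linarith [hy.pos v hv]

lemma IsAdmissibleSpeed.mono (h : IsAdmissibleSpeed f ε c₁) (hf : ContinuousOn f (Icc 0 1))
    (hpos : ∀ s ∈ Ioo (0 : ℝ) 1, 0 < f s) (hε : 0 < ε) (hc : c₁ ≤ c₂) :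
    IsAdmissibleSpeed f ε c₂ := by
  obtain ⟨hc₁, y₁, hy₁, hy₁0⟩ := (isAdmissibleSpeed_iff hpos hε).1 h
  obtain ⟨y₂, hy₂⟩ := exists_isTerminalSolution hε (hc₁.trans hc) hf hpos
  have h0 : (0 : ℝ) ∈ Icc (0 : ℝ) 1 := left_mem_Icc.2 zero_le_one
  exact (isAdmissibleSpeed_iff hpos hε).2 ⟨hc₁.trans hc, y₂, hy₂,
    ((hy₁.le_of_speed_le hy₂ hε hc₁ hc h0).trans_eq hy₁0).antisymm (hy₂.nonneg h0)⟩

lemma exists_isCriticalSpeed (hf : ContinuousOn f (Icc 0 1))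
    (hpos : ∀ s ∈ Ioo (0 : ℝ) 1, 0 < f s) (hε : 0 < ε) (hne : ∃ c, IsAdmissibleSpeed f ε c) :
    ∃ c, IsCriticalSpeed f ε c := by
  set S := {c : ℝ | IsAdmissibleSpeed f ε c}
  have hnn : ∀ c ∈ S, 0 ≤ c := fun c hc => ((isAdmissibleSpeed_iff hpos hε).1 hc).1
  have hbdd : BddBelow S := ⟨0, hnn⟩
  have hinf0 : 0 ≤ sInf S := le_csInf hne hnn
  have h0 : (0 : ℝ) ∈ Icc (0 : ℝ) 1 := left_mem_Icc.2 zero_le_one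
  obtain ⟨y, hy⟩ := exists_isTerminalSolution hε hinf0 hf hpos
  have hinf : IsAdmissibleSpeed f ε (sInf S) := by
    refine (isAdmissibleSpeed_iff hpos hε).2
      ⟨hinf0, y, hy, (le_of_forall_pos_le_add fun δ hδ => ?_).antisymm (hy.nonneg h0)⟩
    obtain ⟨c, hc, hcδ⟩ := exists_lt_of_csInf_lt hne (lt_add_of_pos_right (sInf S) hδ)
    obtain ⟨-, y', hy', hy0'⟩ := (isAdmissibleSpeed_iff hpos hε).1 hc
    linarith [hy.sub_le_speed_sub_mul hy' hε hinf0 (csInf_le hbdd hc) h0]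
  exact ⟨sInf S, Subset.antisymm (fun c hc => csInf_le hbdd hc)
    fun c hc => hinf.mono hf hpos hε hc⟩

lemma hasDerivAt_sqrt_sq_add_sq_sub (hε : 0 < ε) (hq : HasDerivAt q q' v) :
    HasDerivAt (fun x => √(ε ^ 2 + q x ^ 2) - ε) (q v * q' / √(ε ^ 2 + q v ^ 2)) v := by
  have hpos : 0 < ε ^ 2 + q v ^ 2 := by positivity
  have hd : HasDerivAt (fun x => ε ^ 2 + q x ^ 2) (2 * (q v * q')) v :=
    ((hq.pow 2).const_add (ε ^ 2)).congr_deriv (by push_cast; ring)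
  exact ((hd.sqrt hpos.ne').sub_const ε).congr_deriv (mul_div_mul_left _ _ two_ne_zero)

lemma mul_sub_div_sqrt_le {x φ : ℝ} (hε : 0 < ε) (hx : 0 ≤ x) (hφ : 0 ≤ φ)
    (hle : φ * ε ≤ η / 2 * x) :
    x * (L + η / 2 - φ) / √(ε ^ 2 + x ^ 2) ≤ (L + η) * (x / √(ε ^ 2 + x ^ 2)) - φ := by
  have hS : 0 < √(ε ^ 2 + x ^ 2) := by positivity
  have hSle : √(ε ^ 2 + x ^ 2) ≤ ε + x :=
    (Real.sqrt_le_left (by positivity)).2 (by nlinarith)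
  rw [mul_div_assoc', div_sub' hS.ne', div_le_div_iff_of_pos_right hS]
  nlinarith [mul_le_mul_of_nonneg_left hSle hφ]

/-- The supersolution is `√(ε² + q²) - ε`, where `q` is the solution `(L + η / 2) v - F(v)` of the
inviscid equation `q' = L + η / 2 - f(v)`. -/
lemma isAdmissibleSpeed_of_primitive_le (hf : ContinuousOn f (Icc 0 1))
    (hpos : ∀ s ∈ Ioo (0 : ℝ) 1, 0 < f s) (hε : 0 < ε) (hL : 0 ≤ L) (hη : 0 < η)
    (hFL : ∀ s ∈ Icc (0 : ℝ) 1, primitive f s ≤ L * s)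
    (hk : ∀ s ∈ Icc (0 : ℝ) 1, f s ≤ k * s) (hεη : 4 * k * ε ≤ η ^ 2) :
    IsAdmissibleSpeed f ε (L + η) := by
  have hc : 0 ≤ L + η := by positivity
  have h0 : (0 : ℝ) ∈ Icc (0 : ℝ) 1 := left_mem_Icc.2 zero_le_one
  obtain ⟨y, hy⟩ := exists_isTerminalSolution hε hc hf hpos
  refine (isAdmissibleSpeed_iff hpos hε).2 ⟨hc, y, hy, le_antisymm ?_ (hy.nonneg h0)⟩
  set q : ℝ → ℝ := fun v => (L + η / 2) * v - primitive f v with hq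
  have hq_ge : ∀ v ∈ Ioo (0 : ℝ) 1, η / 2 * v ≤ q v := fun v hv => by
    simp only [hq]
    linarith [hFL v (Ioo_subset_Icc_self hv)]
  have hq_nn : ∀ v ∈ Ioo (0 : ℝ) 1, 0 ≤ q v := fun v hv =>
    (mul_nonneg (by positivity) hv.1.le).trans (hq_ge v hv)
  have hqc : ContinuousOn q (Icc 0 1) :=
    ContinuousOn.sub (by fun_prop) (continuousOn_primitive hf)
  have hqd : ∀ v ∈ Ioo (0 : ℝ) 1, HasDerivAt q (L + η / 2 - f v) v := fun v hv =>
    (((hasDerivAt_id v).const_mul (L + η / 2)).sub (hasDerivAt_primitive hf hv)).congr_deriv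
      (by rw [mul_one])
  have hge : ∀ x : ℝ, 0 ≤ √(ε ^ 2 + x ^ 2) - ε := fun x =>
    sub_nonneg.2 (Real.le_sqrt_of_sq_le (by nlinarith [sq_nonneg x]))
  have hle := hy.le_of_supersolution (u := fun v => √(ε ^ 2 + q v ^ 2) - ε) hε hc le_rfl le_rfl
    (((continuousOn_const.add (hqc.pow 2)).sqrt).sub continuousOn_const)
    (fun v _ => hge (q v)) (fun v hv => hasDerivAt_sqrt_sq_add_sq_sub hε (hqd v hv))
    (fun v hv => ?_) (hy.one.trans_le (hge (q 1))) h0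
  · simpa [hq, primitive_zero, Real.sqrt_sq hε.le] using hle
  · rw [reductionR_sqrt_sub ε (hq_nn v hv)]
    refine mul_sub_div_sqrt_le hε (hq_nn v hv) (hpos v hv).le ?_
    have hkv := mul_le_mul_of_nonneg_right (hk v (Ioo_subset_Icc_self hv)) hε.le
    nlinarith [mul_le_mul_of_nonneg_right hεη hv.1.le, hq_ge v hv]

end TerminalSolutions

/-! ### Heteroclinics and the first-order reduction -/

section Gronwall

variable {N N' : ℝ → ℝ} {C a z : ℝ}

lemma pos_of_hasDerivAt_le_mul (hN : ∀ x, HasDerivAt N (N' x) x) (hle : ∀ x, N' x ≤ C * N x)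
    (ha : 0 < N a) (hz : z ≤ a) : 0 < N z := by
  have hanti : Antitone (fun x => N x * Real.exp (-C * x)) :=
    antitone_of_hasDerivAt_nonpos
      (fun x => (hN x).mul ((hasDerivAt_id x).const_mul (-C)).exp) fun x => by
        have hexp := mul_le_mul_of_nonneg_right (hle x) (Real.exp_pos (-C * x)).le
        simp only [id, Pi.zero_apply]
        linarith
  exact pos_of_mul_pos_left ((mul_pos ha (Real.exp_pos _)).trans_le (hanti hz))
    (Real.exp_pos _).le

lemma pos_of_neg_mul_le_hasDerivAt (hN : ∀ x, HasDerivAt N (N' x) x)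
    (hle : ∀ x, -C * N x ≤ N' x) (ha : 0 < N a) (hz : a ≤ z) : 0 < N z := by
  have hmono : Monotone (fun x => N x * Real.exp (C * x)) :=
    monotone_of_hasDerivAt_nonneg
      (fun x => (hN x).mul ((hasDerivAt_id x).const_mul C).exp) fun x => by
        have hexp := mul_le_mul_of_nonneg_right (hle x) (Real.exp_pos (C * x)).le
        simp only [id, Pi.zero_apply]
        linarith
  exact pos_of_mul_pos_left ((mul_pos ha (Real.exp_pos _)).trans_le (hmono hz))
    (Real.exp_pos _).le

end Gronwall

section HeteroclinicExistence

variable {f y : ℝ → ℝ} {ε c k v : ℝ}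

lemma hasDerivAt_sqrt_mul_add (hε : 0 < ε) (hv : 0 < v) :
    HasDerivAt (fun x => √(x * (2 * ε + x))) (reductionR ε v)⁻¹ v := by
  have hd : HasDerivAt (fun x => x * (2 * ε + x)) (2 * (ε + v)) v :=
    ((hasDerivAt_id' v).mul ((hasDerivAt_id' v).const_add (2 * ε))).congr_deriv (by ring)
  refine (hd.sqrt (by positivity)).congr_deriv ?_
  rw [reductionR, inv_div, mul_div_mul_left _ _ two_ne_zero]

lemma reductionR_div_sqrt (hε : 0 < ε) (hv : 0 ≤ v) :
    reductionR ε v / √(1 - reductionR ε v ^ 2) = √(v * (2 * ε + v)) / ε := by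
  rw [reductionR_sq hε hv, sub_sub_cancel, Real.sqrt_sq (by positivity), reductionR,
    div_div_div_cancel_right₀ (by positivity)]

lemma contDiffAt_reductionR (hε : 0 < ε) (hv : 0 < v) : ContDiffAt ℝ 1 (reductionR ε) v := by
  unfold reductionR
  exact ContDiffAt.div (ContDiffAt.sqrt (by fun_prop) (by positivity)) (by fun_prop)
    (by positivity)

namespace IsTerminalSolution

lemma le_sq (h : IsTerminalSolution f ε c y) (hε : 0 < ε) (hc : 0 ≤ c)
    (hk : ∀ s ∈ Icc (0 : ℝ) 1, f s ≤ k * (1 - s)) (hv : v ∈ Icc (0 : ℝ) 1) :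
    y v ≤ k / 2 * (1 - v) ^ 2 := by
  refine le_of_hasDerivAt_le (u := fun x => k / 2 * (1 - x) ^ 2) (u' := fun x => -(k * (1 - x)))
    h.continuousOn (by fun_prop) h.hasDerivAt (fun x _ => ?_) (fun x hx _ => ?_)
    (by simp [h.one]) hv
  · exact ((((hasDerivAt_id' x).const_sub 1).pow 2).const_mul (k / 2)).congr_deriv
      (by push_cast; ring)
  · linarith [mul_nonneg hc (reductionR_nonneg hε (h.pos x hx).le),
      hk x (Ioo_subset_Icc_self hx)]

lemma sqrt_le_mul (h : IsTerminalSolution f ε c y) (hε : 0 < ε) (hc : 0 ≤ c) (h0 : y 0 = 0)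
    (hpos : ∀ s ∈ Ioo (0 : ℝ) 1, 0 < f s) (hv : v ∈ Icc (0 : ℝ) 1) :
    √(y v) ≤ c * √(2 / ε) / 2 * v := by
  have hanti : AntitoneOn (fun v => √(y v) - c * √(2 / ε) / 2 * v) (Icc 0 1) := by
    refine antitoneOn_of_hasDerivWithinAt_nonpos (convex_Icc 0 1)
      (f' := fun x => (c * reductionR ε (y x) - f x) / (2 * √(y x)) - c * √(2 / ε) / 2 * 1)
      (h.continuousOn.sqrt.sub (by fun_prop)) (fun x hx => ?_) fun x hx => ?_
    · rw [interior_Icc] at hx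
      exact (((h.hasDerivAt x hx).sqrt (h.pos x hx).ne').sub
        ((hasDerivAt_id x).const_mul _)).hasDerivWithinAt
    · rw [interior_Icc] at hx
      have hs := Real.sqrt_pos.2 (h.pos x hx)
      have hR := mul_le_mul_of_nonneg_left (reductionR_le_sqrt hε (h.pos x hx).le) hc
      rw [Real.sqrt_mul (by positivity)] at hR
      rw [sub_nonpos, div_le_iff₀ (by positivity)]
      linarith [hpos x hx]
  have hle := hanti (left_mem_Icc.2 zero_le_one) hv hv.1
  simp only [h0, Real.sqrt_zero, mul_zero, sub_zero] at hle
  linarith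

lemma isSpeedField (h : IsTerminalSolution f ε c y) (hε : 0 < ε) (hc : 0 ≤ c) (h0 : y 0 = 0)
    (hpos : ∀ s ∈ Ioo (0 : ℝ) 1, 0 < f s) (hk : ∀ s ∈ Icc (0 : ℝ) 1, f s ≤ k * (1 - s)) :
    IsSpeedField (fun s => reductionR ε (y s)) 0 1 := by
  have hk0 : 0 < k := by
    linarith [hpos (1 / 2) (by norm_num), hk (1 / 2) (by norm_num)]
  set K₀ := √(2 / ε) * (c * √(2 / ε) / 2) with hK₀
  set K₁ := √(2 / ε * (k / 2))
  have hK₀0 : 0 ≤ K₀ := by positivity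
  have hK₁0 : 0 < K₁ := by positivity
  refine ⟨(continuousOn_reductionR hε).comp (h.continuousOn.mono Ioo_subset_Icc_self)
    fun s hs => (h.pos s hs).le, fun s hs => reductionR_pos hε (h.pos s hs), K₀ + K₁,
    by positivity, fun s hs => ?_⟩
  have hsI := Ioo_subset_Icc_self hs
  have hR := reductionR_le_sqrt hε (h.pos s hs).le
  have hleft : reductionR ε (y s) ≤ K₀ * s := by
    rw [Real.sqrt_mul (by positivity)] at hR
    have hsqrt := mul_le_mul_of_nonneg_left (h.sqrt_le_mul hε hc h0 hpos hsI)
      (Real.sqrt_nonneg (2 / ε))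
    rw [hK₀]
    linarith
  have hright : reductionR ε (y s) ≤ K₁ * (1 - s) :=
    calc reductionR ε (y s) ≤ √(2 / ε * (k / 2 * (1 - s) ^ 2)) := hR.trans <|
          Real.sqrt_le_sqrt (mul_le_mul_of_nonneg_left (h.le_sq hε hc hk hsI) (by positivity))
      _ = K₁ * (1 - s) := by
          rw [← mul_assoc, Real.sqrt_mul (by positivity), Real.sqrt_sq (sub_nonneg.2 hs.2.le)]
  constructor
  · nlinarith [hs.1]
  · nlinarith [hs.2]

lemma contDiffOn (h : IsTerminalSolution f ε c y) (hε : 0 < ε) (hf : ContinuousOn f (Icc 0 1)) :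
    ContDiffOn ℝ 1 y (Ioo 0 1) := by
  rw [show (1 : WithTop ℕ∞) = 0 + 1 from rfl, contDiffOn_succ_iff_deriv_of_isOpen isOpen_Ioo,
    contDiffOn_zero]
  have hd : ContinuousOn (fun v => c * reductionR ε (y v) - f v) (Ioo 0 1) :=
    (continuousOn_const.mul ((continuousOn_reductionR hε).comp
      (h.continuousOn.mono Ioo_subset_Icc_self) fun s hs => (h.pos s hs).le)).sub
      (hf.mono Ioo_subset_Icc_self)
  exact ⟨fun v hv => (h.hasDerivAt v hv).differentiableAt.differentiableWithinAt, by simp,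
    hd.congr fun v hv => (h.hasDerivAt v hv).deriv⟩

lemma hasDerivAt_flux_flow (h : IsTerminalSolution f ε c y) (hε : 0 < ε) {w : ℝ → ℝ} {z : ℝ}
    (hw : ∀ x, w x ∈ Ioo (0 : ℝ) 1) (hd : ∀ x, HasDerivAt w (reductionR ε (y (w x))) x) :
    HasDerivAt (fun x => deriv w x / √(1 - deriv w x ^ 2))
      ((c * reductionR ε (y (w z)) - f (w z)) / ε) z := by
  have hflux : (fun x => deriv w x / √(1 - deriv w x ^ 2)) =
      fun x => √(y (w x) * (2 * ε + y (w x))) / ε := funext fun x => by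
    rw [(hd x).deriv, reductionR_div_sqrt hε (h.pos _ (hw x)).le]
  have hy := h.pos _ (hw z)
  rw [hflux]
  refine (((hasDerivAt_sqrt_mul_add hε hy).comp z
    ((h.hasDerivAt _ (hw z)).comp z (hd z))).div_const ε).congr_deriv ?_
  have hR := reductionR_pos hε hy
  field_simp

lemma isHeteroclinic_flow (h : IsTerminalSolution f ε c y) (hε : 0 < ε)
    (hf : ContinuousOn f (Icc 0 1)) (hG : IsSpeedField (fun s => reductionR ε (y s)) 0 1)
    (hv : v ∈ Ioo (0 : ℝ) 1) : IsHeteroclinic f ε c (hG.flow hv) := by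
  have hderiv : deriv (hG.flow hv) = fun z => reductionR ε (y (hG.flow hv z)) :=
    funext fun z => (hG.hasDerivAt_flow hv z).deriv
  have hdiff : Differentiable ℝ (hG.flow hv) := fun z =>
    (hG.hasDerivAt_flow hv z).differentiableAt
  have hRy : ContDiffOn ℝ 1 (fun s => reductionR ε (y s)) (Ioo 0 1) := fun s hs =>
    (contDiffAt_reductionR hε (h.pos s hs)).comp_contDiffWithinAt s (h.contDiffOn hε hf s hs)
  have hC1 : ContDiff ℝ 1 (hG.flow hv) := by
    rw [contDiff_one_iff_deriv, hderiv]
    exact ⟨hdiff, hG.continuousOn.comp_continuous (hG.continuous_flow hv) (hG.flow_mem hv)⟩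
  refine ⟨?_, fun z => ?_, fun z => ?_, (hG.strictMono_flow hv).monotone,
    hG.tendsto_flow_atBot hv, hG.tendsto_flow_atTop hv⟩
  · rw [show (2 : WithTop ℕ∞) = 1 + 1 from rfl, contDiff_succ_iff_deriv, hderiv]
    exact ⟨hdiff, by simp, hRy.comp_contDiff hC1 (hG.flow_mem hv)⟩
  · have hy := (h.pos _ (hG.flow_mem hv z)).le
    rw [hderiv, abs_of_nonneg (reductionR_nonneg hε hy)]
    exact reductionR_lt_one hε hy
  · rw [(h.hasDerivAt_flux_flow hε (hG.flow_mem hv) (hG.hasDerivAt_flow hv)).deriv,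
      (hG.hasDerivAt_flow hv z).deriv, mul_div_cancel₀ _ hε.ne']
    ring

end IsTerminalSolution

end HeteroclinicExistence

section HeteroclinicUniqueness

variable {f w y φ ω X Z : ℝ → ℝ} {ε c k z z₀ ρ B : ℝ}

/-- The quantity `ε (1 / √(1 - w'²) - 1)`, which is `y ∘ w` when `w' = R_ε(y(w))`. It is written
through the flux `w' / √(1 - w'²)`, the quantity that the profile equation differentiates. -/
noncomputable def fluxEnergy (ε : ℝ) (w : ℝ → ℝ) (z : ℝ) : ℝ :=
  √(ε ^ 2 + (ε * (deriv w z / √(1 - deriv w z ^ 2))) ^ 2) - ε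

lemma fluxEnergy_nonneg (ε : ℝ) (w : ℝ → ℝ) (z : ℝ) : 0 ≤ fluxEnergy ε w z :=
  sub_nonneg.2 (Real.le_sqrt_of_sq_le (le_add_of_nonneg_right (sq_nonneg _)))

lemma mul_div_sqrt_sq_add_sq {r : ℝ} (hε : 0 < ε) (hr : |r| < 1) :
    ε * (r / √(1 - r ^ 2)) / √(ε ^ 2 + (ε * (r / √(1 - r ^ 2))) ^ 2) = r := by
  have hr2 : 0 < 1 - r ^ 2 := sub_pos.2 ((sq_lt_one_iff_abs_lt_one r).2 hr)
  have hs : 0 < √(1 - r ^ 2) := Real.sqrt_pos.2 hr2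
  have hsum : ε ^ 2 + (ε * (r / √(1 - r ^ 2))) ^ 2 = (ε / √(1 - r ^ 2)) ^ 2 := by
    rw [mul_pow, div_pow, div_pow, Real.sq_sqrt hr2.le]
    field_simp
    ring
  rw [hsum, Real.sqrt_sq (by positivity), ← mul_div_assoc, div_div_div_cancel_right₀ hs.ne',
    mul_div_cancel_left₀ _ hε.ne']

/-- The difference of two solutions can only grow forwards, so far to the right it decides
everywhere. -/
lemma le_of_hasDerivAt_reductionR (hε : 0 < ε) (hc : 0 ≤ c) (hω : ∀ x, 0 ≤ ω x)
    (hZ : ∀ x, 0 ≤ Z x)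
    (hXd : ∀ x, HasDerivAt X ((c * reductionR ε (X x) - φ x) * ω x) x)
    (hZd : ∀ x, HasDerivAt Z ((c * reductionR ε (Z x) - φ x) * ω x) x)
    (hfar : ∀ δ > 0, ∃ b ≥ z, X b ≤ Z b + δ) : X z ≤ Z z := by
  refine le_of_forall_pos_le_add fun δ hδ => ?_
  obtain ⟨b, hzb, hb⟩ := hfar δ hδ
  have hZδ : ∀ x, HasDerivAt (fun x => Z x + δ) ((c * reductionR ε (Z x) - φ x) * ω x) x :=
    fun x => (hZd x).add_const δ
  refine le_of_hasDerivAt_le (fun x _ => (hXd x).continuousAt.continuousWithinAt)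
    (fun x _ => (hZδ x).continuousAt.continuousWithinAt) (fun x _ => hXd x) (fun x _ => hZδ x)
    (fun x _ hlt => mul_le_mul_of_nonneg_right (sub_le_sub_right ?_ _) (hω x)) hb
    (left_mem_Icc.2 hzb)
  exact mul_le_mul_of_nonneg_left (reductionR_mono hε (hZ x) (by linarith)) hc

namespace IsHeteroclinic

lemma mem_Icc (h : IsHeteroclinic f ε c w) (z : ℝ) : w z ∈ Icc (0 : ℝ) 1 :=
  ⟨h.monotone.le_of_tendsto h.tendsto_atBot z, h.monotone.ge_of_tendsto h.tendsto_atTop z⟩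

lemma hasDerivAt (h : IsHeteroclinic f ε c w) (z : ℝ) : HasDerivAt w (deriv w z) z :=
  (h.contDiff.differentiable two_ne_zero z).hasDerivAt

lemma deriv_nonneg (h : IsHeteroclinic f ε c w) (z : ℝ) : 0 ≤ deriv w z :=
  h.monotone.deriv_nonneg

lemma one_sub_sq_pos (h : IsHeteroclinic f ε c w) (z : ℝ) : 0 < 1 - deriv w z ^ 2 :=
  sub_pos.2 ((sq_lt_one_iff_abs_lt_one _).2 (h.abs_deriv_lt_one z))

lemma hasDerivAt_flux (h : IsHeteroclinic f ε c w) (hε : 0 < ε) (z : ℝ) :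
    HasDerivAt (fun x => deriv w x / √(1 - deriv w x ^ 2)) ((c * deriv w z - f (w z)) / ε) z := by
  have hd : DifferentiableAt ℝ (deriv w) z :=
    (h.contDiff.differentiable_deriv_two) z
  have hflux : DifferentiableAt ℝ (fun x => deriv w x / √(1 - deriv w x ^ 2)) z :=
    hd.div (((hd.pow 2).const_sub 1).sqrt (h.one_sub_sq_pos z).ne')
      (Real.sqrt_pos.2 (h.one_sub_sq_pos z)).ne'
  refine hflux.hasDerivAt.congr_deriv ?_
  rw [eq_div_iff hε.ne']
  linarith [h.equation z]

lemma deriv_le_flux (h : IsHeteroclinic f ε c w) (z : ℝ) :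
    deriv w z ≤ deriv w z / √(1 - deriv w z ^ 2) := by
  rw [le_div_iff₀ (Real.sqrt_pos.2 (h.one_sub_sq_pos z))]
  exact mul_le_of_le_one_right (h.deriv_nonneg z)
    (Real.sqrt_le_one.2 (sub_le_self _ (sq_nonneg _)))

lemma lt_one (h : IsHeteroclinic f ε c w) (hε : 0 < ε) (hc : 0 ≤ c) (h0 : w z₀ < 1)
    (hk0 : 0 ≤ k) (hk : ∀ s ∈ Icc (0 : ℝ) 1, f s ≤ k * (1 - s)) (z : ℝ) : w z < 1 := by
  rcases le_total z z₀ with hz | hz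
  · exact (h.monotone hz).trans_lt h0
  have hN : 0 < deriv w z / √(1 - deriv w z ^ 2) + (1 - w z) := by
    refine pos_of_neg_mul_le_hasDerivAt (C := 1 + k / ε) (a := z₀)
      (N := fun x => deriv w x / √(1 - deriv w x ^ 2) + (1 - w x))
      (fun x => (h.hasDerivAt_flux hε x).add ((h.hasDerivAt x).const_sub 1)) (fun x => ?_)
      (add_pos_of_nonneg_of_pos ((h.deriv_nonneg z₀).trans (h.deriv_le_flux z₀))
        (sub_pos.2 h0)) hz
    have hflux := h.deriv_le_flux x
    have hf : f (w x) / ε ≤ k / ε * (1 - w x) := by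
      rw [div_mul_eq_mul_div]
      exact div_le_div_of_nonneg_right (hk _ (h.mem_Icc x)) hε.le
    have hcd : 0 ≤ c * deriv w x / ε := div_nonneg (mul_nonneg hc (h.deriv_nonneg x)) hε.le
    have hkd : 0 ≤ k / ε * (deriv w x / √(1 - deriv w x ^ 2)) :=
      mul_nonneg (by positivity) ((h.deriv_nonneg x).trans hflux)
    rw [sub_div]
    linarith [(h.mem_Icc x).2]
  refine (h.mem_Icc z).2.lt_of_ne fun h1 => ?_
  have hmax : IsLocalMax w z := Eventually.of_forall fun x => h1 ▸ (h.mem_Icc x).2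
  simp [hmax.deriv_eq_zero, h1] at hN

lemma pos (h : IsHeteroclinic f ε c w) (hε : 0 < ε) (hc : 0 ≤ c) (h0 : 0 < w z₀)
    (hf : ∀ s ∈ Icc (0 : ℝ) 1, 0 ≤ f s) (z : ℝ) : 0 < w z := by
  rcases le_total z₀ z with hz | hz
  · exact h0.trans_le (h.monotone hz)
  have hN : 0 < deriv w z / √(1 - deriv w z ^ 2) + w z := by
    refine pos_of_hasDerivAt_le_mul (C := c / ε + 1) (a := z₀)
      (N := fun x => deriv w x / √(1 - deriv w x ^ 2) + w x)
      (fun x => (h.hasDerivAt_flux hε x).add (h.hasDerivAt x)) (fun x => ?_)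
      (add_pos_of_nonneg_of_pos ((h.deriv_nonneg z₀).trans (h.deriv_le_flux z₀)) h0) hz
    have hcε : 0 ≤ c / ε := div_nonneg hc hε.le
    have hflux := h.deriv_le_flux x
    have hcflux := mul_le_mul_of_nonneg_left hflux hcε
    have hf0 : 0 ≤ f (w x) / ε := div_nonneg (hf _ (h.mem_Icc x)) hε.le
    have hcw := mul_nonneg hcε (h.mem_Icc x).1
    rw [sub_div, ← div_mul_eq_mul_div]
    linarith [(h.mem_Icc x).1]
  refine (h.mem_Icc z).1.lt_of_ne' fun h1 => ?_
  have hmin : IsLocalMin w z := Eventually.of_forall fun x => h1 ▸ (h.mem_Icc x).1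
  simp [hmin.deriv_eq_zero, h1] at hN

lemma exists_deriv_lt (h : IsHeteroclinic f ε c w) (hρ : 0 < ρ) (B : ℝ) :
    ∃ b ≥ B, deriv w b < ρ := by
  obtain ⟨b, hb, hbe⟩ := exists_hasDerivAt_eq_slope w (deriv w)
    (show B < B + 2 / ρ from lt_add_of_pos_right _ (by positivity))
    h.contDiff.continuous.continuousOn fun x _ => h.hasDerivAt x
  refine ⟨b, hb.1.le, ?_⟩
  rw [hbe, add_sub_cancel_left, div_lt_iff₀ (by positivity), mul_div_cancel₀ _ hρ.ne']
  linarith [(h.mem_Icc (B + 2 / ρ)).2, (h.mem_Icc B).1]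

lemma reductionR_fluxEnergy (h : IsHeteroclinic f ε c w) (hε : 0 < ε) (z : ℝ) :
    reductionR ε (fluxEnergy ε w z) = deriv w z := by
  rw [fluxEnergy, reductionR_sqrt_sub ε
    (mul_nonneg hε.le ((h.deriv_nonneg z).trans (h.deriv_le_flux z)))]
  exact mul_div_sqrt_sq_add_sq hε (h.abs_deriv_lt_one z)

lemma hasDerivAt_fluxEnergy (h : IsHeteroclinic f ε c w) (hε : 0 < ε) (z : ℝ) :
    HasDerivAt (fluxEnergy ε w)
      ((c * reductionR ε (fluxEnergy ε w z) - f (w z)) * deriv w z) z := by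
  refine (hasDerivAt_sqrt_sq_add_sq_sub hε
    ((h.hasDerivAt_flux hε z).const_mul ε)).congr_deriv ?_
  rw [h.reductionR_fluxEnergy hε, mul_div_right_comm,
    mul_div_sqrt_sq_add_sq hε (h.abs_deriv_lt_one z), mul_div_cancel₀ _ hε.ne', mul_comm]

lemma exists_fluxEnergy_le (h : IsHeteroclinic f ε c w) (hε : 0 < ε) {δ : ℝ} (hδ : 0 < δ)
    (B : ℝ) : ∃ b ≥ B, fluxEnergy ε w b ≤ δ := by
  obtain ⟨b, hb, hlt⟩ := h.exists_deriv_lt (reductionR_pos hε hδ) B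
  refine ⟨b, hb, le_of_not_gt fun hgt => hlt.not_ge ?_⟩
  rw [← h.reductionR_fluxEnergy hε]
  exact reductionR_mono hε hδ.le hgt.le

lemma fluxEnergy_eq (h : IsHeteroclinic f ε c w) (hy : IsTerminalSolution f ε c y)
    (hε : 0 < ε) (hc : 0 ≤ c) (hw : ∀ z, w z ∈ Ioo (0 : ℝ) 1) (z : ℝ) :
    fluxEnergy ε w z = y (w z) := by
  have hyd : ∀ x, HasDerivAt (fun x => y (w x))
      ((c * reductionR ε (y (w x)) - f (w x)) * deriv w x) x := fun x =>
    (hy.hasDerivAt _ (hw x)).comp x (h.hasDerivAt x)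
  have hlim : Tendsto (fun x => y (w x)) atTop (𝓝 0) := by
    rw [← hy.one]
    exact (hy.continuousOn 1 (right_mem_Icc.2 zero_le_one)).tendsto.comp
      (tendsto_nhdsWithin_iff.2 ⟨h.tendsto_atTop, Eventually.of_forall h.mem_Icc⟩)
  apply le_antisymm
  · refine le_of_hasDerivAt_reductionR hε hc h.deriv_nonneg (fun x => (hy.pos _ (hw x)).le)
      (h.hasDerivAt_fluxEnergy hε) hyd fun δ hδ => ?_
    obtain ⟨b, hb, hle⟩ := h.exists_fluxEnergy_le hε hδ z
    exact ⟨b, hb, hle.trans (le_add_of_nonneg_left (hy.pos _ (hw b)).le)⟩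
  · refine le_of_hasDerivAt_reductionR hε hc h.deriv_nonneg (fluxEnergy_nonneg ε w)
      hyd (h.hasDerivAt_fluxEnergy hε) fun δ hδ => ?_
    obtain ⟨b, hlt, hb⟩ := ((hlim.eventually_lt_const hδ).and (eventually_ge_atTop z)).exists
    exact ⟨b, hb, hlt.le.trans (le_add_of_nonneg_left (fluxEnergy_nonneg ε w b))⟩

lemma hasDerivAt_reductionR (h : IsHeteroclinic f ε c w) (hy : IsTerminalSolution f ε c y)
    (hε : 0 < ε) (hc : 0 ≤ c) (hw : ∀ z, w z ∈ Ioo (0 : ℝ) 1) (z : ℝ) :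
    HasDerivAt w (reductionR ε (y (w z))) z := by
  rw [← h.fluxEnergy_eq hy hε hc hw, h.reductionR_fluxEnergy hε]
  exact h.hasDerivAt z

lemma eq_flow (h : IsHeteroclinic f ε c w) (hy : IsTerminalSolution f ε c y) (hε : 0 < ε)
    (hc : 0 ≤ c) (hpos : ∀ s ∈ Icc (0 : ℝ) 1, 0 ≤ f s)
    (hk : ∀ s ∈ Icc (0 : ℝ) 1, f s ≤ k * (1 - s))
    (hG : IsSpeedField (fun s => reductionR ε (y s)) 0 1) (hw0 : w 0 ∈ Ioo (0 : ℝ) 1) :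
    w = hG.flow hw0 := by
  have hk0 : 0 ≤ k := by
    linarith [hpos 0 (left_mem_Icc.2 zero_le_one), hk 0 (left_mem_Icc.2 zero_le_one)]
  have hw : ∀ z, w z ∈ Ioo (0 : ℝ) 1 := fun z =>
    ⟨h.pos hε hc hw0.1 hpos z, h.lt_one hε hc hw0.2 hk0 hk z⟩
  funext z
  rw [hG.eq_flow hw (h.hasDerivAt_reductionR hy hε hc hw) hw0 z, sub_zero]

end IsHeteroclinic

end HeteroclinicUniqueness

/-! ### Critical speeds and terminal solutions as `ε → 0⁺` -/

lemma IsCriticalSpeed.isAdmissibleSpeed {f : ℝ → ℝ} {ε c : ℝ} (h : IsCriticalSpeed f ε c) :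
    IsAdmissibleSpeed f ε c :=
  (Eq.symm h).subset self_mem_Ici

/-- The pointwise limit of the speeds `R_ε(y_ε)` along critical solutions `y_ε` as `ε → 0⁺`: the
constant `1` up to the tangency point `p`, and the inviscid speed `f / f(p)` beyond it. -/
noncomputable def limitSpeed (f : ℝ → ℝ) (p s : ℝ) : ℝ := f (max s p) / f p

/-- Terminal solutions `y ε` that vanish at `0` too, at speeds `c ε` decreasing to `f p`. -/
structure IsVanishingFamily (f : ℝ → ℝ) (p : ℝ) (c : ℝ → ℝ) (y : ℝ → ℝ → ℝ) : Prop where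
  tendsto : Tendsto c (𝓝[>] 0) (𝓝 (f p))
  lt : ∀ ε > 0, f p < c ε
  isTerminalSolution : ∀ ε > 0, IsTerminalSolution f ε (c ε) (y ε)
  zero : ∀ ε > 0, y ε 0 = 0

section LimitBounds

variable {f y : ℝ → ℝ} {m p ε c k v v' s : ℝ}

lemma IsTerminalSolution.primitive_sub_le_of_antitoneOn (h : IsTerminalSolution f ε c y)
    (hf : ContinuousOn f (Icc 0 1)) (hε : 0 < ε) (hc : 0 ≤ c) (hv : 0 ≤ v) (hvv' : v ≤ v')
    (hv' : v' ≤ 1) (hy : AntitoneOn y (Icc v v')) :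
    primitive f v' - primitive f v ≤ c * reductionR ε (y v) * (v' - v) + (y v - y v') := by
  have hsub : Icc v v' ⊆ Icc 0 1 := Icc_subset_Icc hv hv'
  have hanti : AntitoneOn (fun x => y x + primitive f x - c * reductionR ε (y v) * x)
      (Icc v v') := by
    refine antitoneOn_of_hasDerivWithinAt_nonpos (convex_Icc v v')
      (f' := fun x => c * reductionR ε (y x) - f x + f x - c * reductionR ε (y v) * 1)
      (((h.continuousOn.add (continuousOn_primitive hf)).mono hsub).sub (by fun_prop))
      (fun x hx => ?_) fun x hx => ?_
    all_goals
      rw [interior_Icc] at hx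
      have hx' : x ∈ Ioo (0 : ℝ) 1 := ⟨hv.trans_lt hx.1, hx.2.trans_le hv'⟩
    · exact (((h.hasDerivAt x hx').add (hasDerivAt_primitive hf hx')).sub
        ((hasDerivAt_id x).const_mul _)).hasDerivWithinAt
    · have hyx := hy (left_mem_Icc.2 hvv') (Ioo_subset_Icc_self hx) hx.1.le
      have hR := mul_le_mul_of_nonneg_left (reductionR_mono hε (h.pos x hx').le hyx) hc
      linarith
  have hle := hanti (left_mem_Icc.2 hvv') (right_mem_Icc.2 hvv') hvv'
  dsimp only at hle
  linarith

namespace IsTangency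

lemma limitSpeed_of_le (h : IsTangency f m p) (hs : s ≤ p) : limitSpeed f p s = 1 := by
  rw [limitSpeed, max_eq_right hs, div_self h.f_p_pos.ne']

lemma limitSpeed_pos (h : IsTangency f m p) (hs : s ∈ Ioo (0 : ℝ) 1) : 0 < limitSpeed f p s :=
  div_pos (h.pos _ ⟨lt_max_of_lt_left hs.1, max_lt hs.2 h.lt_one⟩) h.f_p_pos

lemma continuousOn_limitSpeed (h : IsTangency f m p) :
    ContinuousOn (limitSpeed f p) (Ioo 0 1) :=
  (h.continuousOn.comp (by fun_prop) fun _ hs =>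
    ⟨le_max_of_le_left hs.1.le, (max_lt hs.2 h.lt_one).le⟩).div_const _

lemma isAdmissibleSpeed (h : IsTangency f m p) (hε : 0 < ε)
    (hk : ∀ s ∈ Icc (0 : ℝ) 1, f s ≤ k * s) : IsAdmissibleSpeed f ε (f p + √(4 * k * ε)) := by
  have hk0 : 0 < k := by
    linarith [h.pos (1 / 2) (by norm_num), hk (1 / 2) (by norm_num)]
  exact isAdmissibleSpeed_of_primitive_le h.continuousOn h.pos hε h.f_p_pos.le (by positivity)
    (fun s hs => h.primitive_le hs) hk (Real.sq_sqrt (by positivity)).ge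

lemma lt_of_isAdmissibleSpeed (h : IsTangency f m p) (hε : 0 < ε)
    (hc : IsAdmissibleSpeed f ε c) : f p < c := by
  have hlt := hc.primitive_lt h.continuousOn h.pos hε h.p_mem
  rw [h.primitive_eq] at hlt
  exact lt_of_mul_lt_mul_right hlt h.p_pos.le

lemma exists_isVanishingFamily (h : IsTangency f m p) (hk : ∀ s ∈ Icc (0 : ℝ) 1, f s ≤ k * s) :
    ∃ c y, (∀ ε > 0, IsCriticalSpeed f ε (c ε)) ∧ IsVanishingFamily f p c y := by
  have hexists : ∀ ε : ℝ, ∃ c, 0 < ε → IsCriticalSpeed f ε c := fun ε => by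
    by_cases hε : 0 < ε
    · exact (exists_isCriticalSpeed h.continuousOn h.pos hε ⟨_, h.isAdmissibleSpeed hε hk⟩).imp
        fun _ hc _ => hc
    · exact ⟨0, fun hε' => absurd hε' hε⟩
  choose c hc using hexists
  have hsol : ∀ ε : ℝ, ∃ y, 0 < ε → IsTerminalSolution f ε (c ε) y ∧ y 0 = 0 := fun ε => by
    by_cases hε : 0 < ε
    · exact ((isAdmissibleSpeed_iff h.pos hε).1 (hc ε hε).isAdmissibleSpeed).2.imp
        fun _ hy _ => hy
    · exact ⟨0, fun hε' => absurd hε' hε⟩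
  choose y hy using hsol
  have hlt : ∀ ε > 0, f p < c ε := fun ε hε =>
    h.lt_of_isAdmissibleSpeed hε (hc ε hε).isAdmissibleSpeed
  have hle : ∀ ε > 0, c ε ≤ f p + √(4 * k * ε) := fun ε hε =>
    (hc ε hε).subset (h.isAdmissibleSpeed hε hk)
  have hsqrt : Tendsto (fun ε => f p + √(4 * k * ε)) (𝓝[>] 0) (𝓝 (f p)) := by
    have hcont : Continuous fun ε => f p + √(4 * k * ε) := by fun_prop
    simpa using (hcont.tendsto 0).mono_left nhdsWithin_le_nhds
  refine ⟨c, y, hc, ?_, hlt, fun ε hε => (hy ε hε).1, fun ε hε => (hy ε hε).2⟩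
  exact tendsto_of_tendsto_of_tendsto_of_le_of_le' tendsto_const_nhds hsqrt
    (eventually_mem_nhdsWithin.mono fun ε hε => (hlt ε hε).le)
    (eventually_mem_nhdsWithin.mono hle)

/-- Above the nullcline, a constant slightly below `y v` would be a supersolution on `[v, 1]`. -/
lemma speed_mul_reductionR_le (h : IsTangency f m p) (hy : IsTerminalSolution f ε c y)
    (hε : 0 < ε) (hc : 0 ≤ c) (hmv : m ≤ v) (hv1 : v < 1) : c * reductionR ε (y v) ≤ f v := by
  by_contra! hlt
  have hv0 : 0 < v := h.m_pos.trans_le hmv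
  have hyv := hy.pos v ⟨hv0, hv1⟩
  have hcont : ContinuousAt (fun M => c * reductionR ε M) (y v) :=
    continuousAt_const.mul ((continuousOn_reductionR hε).continuousAt (Ici_mem_nhds hyv))
  obtain ⟨M, ⟨hM, hM0⟩, hMy⟩ := ((((hcont.eventually (lt_mem_nhds hlt)).and
    (lt_mem_nhds hyv)).filter_mono nhdsWithin_le_nhds).and
    (self_mem_nhdsWithin (s := Iio (y v)))).exists
  refine (hy.le_of_supersolution (a := v) (b := 1) (u := fun _ => M) (u' := fun _ => 0) hε hc
    hv0.le le_rfl continuousOn_const (fun x _ => hM0.le) (fun x _ => hasDerivAt_const x M)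
    (fun x hx => ?_) (hy.one.trans_le hM0.le) (left_mem_Icc.2 hv1.le)).not_gt hMy
  have hfx := h.strictAntiOn ⟨hmv, hv1.le⟩ ⟨hmv.trans hx.1.le, hx.2.le⟩ hx.1
  linarith

lemma antitoneOn_terminalSolution (h : IsTangency f m p) (hy : IsTerminalSolution f ε c y)
    (hε : 0 < ε) (hc : 0 ≤ c) : AntitoneOn y (Icc m 1) := by
  refine antitoneOn_of_hasDerivWithinAt_nonpos (convex_Icc m 1)
    (f' := fun v => c * reductionR ε (y v) - f v)
    (hy.continuousOn.mono (Icc_subset_Icc_left h.m_pos.le)) (fun v hv => ?_) fun v hv => ?_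
  all_goals rw [interior_Icc] at hv
  · exact (hy.hasDerivAt v ⟨h.m_pos.trans hv.1, hv.2⟩).hasDerivWithinAt
  · exact sub_nonpos.2 (h.speed_mul_reductionR_le hy hε hc hv.1.le hv.2)

lemma terminalSolution_le_speed_sub (h : IsTangency f m p) (hy : IsTerminalSolution f ε c y)
    (hy0 : y 0 = 0) (hε : 0 < ε) (hc : f p < c) : y p ≤ c - f p := by
  have hle := hy.antitoneOn_add_primitive_sub h.continuousOn hε (h.f_p_pos.trans hc).le
    (left_mem_Icc.2 zero_le_one) (Ioo_subset_Icc_self h.p_mem) h.p_pos.le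
  simp only [hy0, primitive_zero, h.primitive_eq] at hle
  nlinarith [h.lt_one]

lemma mul_sub_primitive_sub_le_terminalSolution (h : IsTangency f m p)
    (hy : IsTerminalSolution f ε c y) (hε : 0 < ε) (hc : f p < c) (hv : 0 ≤ v) (hvp : v ≤ p) :
    f p * v - primitive f v - (c - f p) ≤ y v := by
  have hle := hy.antitoneOn_add_primitive_sub h.continuousOn hε (h.f_p_pos.trans hc).le
    ⟨hv, hvp.trans h.lt_one.le⟩ (Ioo_subset_Icc_self h.p_mem) hvp
  simp only [h.primitive_eq] at hle
  nlinarith [h.lt_one, hy.pos p h.p_mem, mul_nonneg (sub_pos.2 hc).le hv]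

lemma sub_mul_sub_reductionR_le (h : IsTangency f m p) (hy : IsTerminalSolution f ε c y)
    (hy0 : y 0 = 0) (hε : 0 < ε) (hc : f p < c) (hpv : p ≤ v) (hvv' : v < v') (hv' : v' < 1) :
    (v' - v) * (f v' - c * reductionR ε (y v)) ≤ c - f p := by
  have hc0 : 0 ≤ c := (h.f_p_pos.trans hc).le
  have hv0 : 0 < v := h.p_pos.trans_le hpv
  have hmv : m ≤ v := h.m_lt.le.trans hpv
  have hanti := h.antitoneOn_terminalSolution hy hε hc0
  have hprim := hy.primitive_sub_le_of_antitoneOn h.continuousOn hε hc0 hv0.le hvv'.le hv'.le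
    (hanti.mono (Icc_subset_Icc hmv hv'.le))
  have htangent := primitive_lt_tangent h.continuousOn h.m_pos.le le_rfl h.strictAntiOn
    ⟨hv0.trans hvv', hv'⟩ ⟨hmv.trans hvv'.le, hv'.le⟩ ⟨hmv, (hvv'.trans hv').le⟩ hvv'.ne
  have hyv : y v ≤ y p :=
    hanti ⟨h.m_lt.le, h.lt_one.le⟩ ⟨hmv, (hvv'.trans hv').le⟩ hpv
  have hyp := h.terminalSolution_le_speed_sub hy hy0 hε hc
  have hyv' := hy.pos v' ⟨hv0.trans hvv', hv'⟩
  linarith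

end IsTangency

end LimitBounds

namespace IsVanishingFamily

variable {f c : ℝ → ℝ} {y : ℝ → ℝ → ℝ} {m p s s₀ κ a b r : ℝ}

lemma eventually_lt_reductionR_of_le_sub (H : IsVanishingFamily f p c y) (h : IsTangency f m p)
    (ha : 0 ≤ a) (hb : b ≤ p) (hκ : 0 < κ) (hle : ∀ s ∈ Icc a b, κ ≤ f p * s - primitive f s)
    (hr : r < 1) : ∀ᶠ ε in 𝓝[>] (0 : ℝ), ∀ s ∈ Icc a b, r < reductionR ε (y ε s) := by
  have hspeed : ∀ᶠ ε in 𝓝[>] (0 : ℝ), c ε < f p + κ / 2 :=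
    H.tendsto.eventually (gt_mem_nhds (by linarith))
  have hlim : Tendsto (fun ε : ℝ => 1 - ε / (κ / 2)) (𝓝[>] 0) (𝓝 1) := by
    have hcont : Continuous fun ε : ℝ => 1 - ε / (κ / 2) := by fun_prop
    simpa using (hcont.tendsto 0).mono_left nhdsWithin_le_nhds
  filter_upwards [hspeed, hlim.eventually (lt_mem_nhds hr), self_mem_nhdsWithin]
    with ε hcε hrε (hε : 0 < ε) s hs
  have hy := h.mul_sub_primitive_sub_le_terminalSolution (H.isTerminalSolution ε hε) hε
    (H.lt ε hε) (ha.trans hs.1) (hs.2.trans hb)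
  have hκy : κ / 2 ≤ y ε s := by linarith [hle s hs]
  calc r < 1 - ε / (κ / 2) := hrε
    _ ≤ 1 - ε / (ε + y ε s) := by gcongr; linarith
    _ ≤ reductionR ε (y ε s) := one_sub_div_le_reductionR hε (by linarith)

lemma reductionR_le_limitSpeed (H : IsVanishingFamily f p c y) (h : IsTangency f m p) {ε : ℝ}
    (hε : 0 < ε) (hs : s ∈ Ioo (0 : ℝ) 1) : reductionR ε (y ε s) ≤ limitSpeed f p s := by
  have hy := H.isTerminalSolution ε hε
  rcases le_or_gt s p with hsp | hsp
  · rw [h.limitSpeed_of_le hsp]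
    exact (reductionR_lt_one hε (hy.pos s hs).le).le
  · rw [limitSpeed, max_eq_left hsp.le, le_div_iff₀ h.f_p_pos, mul_comm]
    exact (mul_le_mul_of_nonneg_right (H.lt ε hε).le
      (reductionR_nonneg hε (hy.pos s hs).le)).trans
      (h.speed_mul_reductionR_le hy hε (h.f_p_pos.trans (H.lt ε hε)).le
        (h.m_lt.trans hsp).le hs.2)

lemma eventually_lt_reductionR_of_ge (H : IsVanishingFamily f p c y) (h : IsTangency f m p)
    (hps : p ≤ s) (hs : s < 1) (hr : r < f s / f p) :
    ∀ᶠ ε in 𝓝[>] (0 : ℝ), r < reductionR ε (y ε s) := by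
  rw [lt_div_iff₀ h.f_p_pos] at hr
  have hcont := h.continuousOn.continuousAt (Icc_mem_nhds (h.p_pos.trans_le hps) hs)
  obtain ⟨v, ⟨hv, hv1⟩, hsv⟩ := ((((hcont.eventually (lt_mem_nhds hr)).and
    (gt_mem_nhds hs)).filter_mono nhdsWithin_le_nhds).and
    (self_mem_nhdsWithin (s := Ioi s))).exists
  have hlim : Tendsto (fun ε => (f v - (c ε - f p) / (v - s)) / c ε) (𝓝[>] 0)
      (𝓝 ((f v - (f p - f p) / (v - s)) / f p)) :=
    (((H.tendsto.sub_const _).div_const _).const_sub _).div H.tendsto h.f_p_pos.ne'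
  have hlt : r < (f v - (f p - f p) / (v - s)) / f p := by
    rwa [sub_self, zero_div, sub_zero, lt_div_iff₀ h.f_p_pos]
  filter_upwards [hlim.eventually (lt_mem_nhds hlt), self_mem_nhdsWithin] with ε hrε hε
  refine hrε.trans_le ?_
  have hle := h.sub_mul_sub_reductionR_le (H.isTerminalSolution ε hε) (H.zero ε hε) hε
    (H.lt ε hε) hps hsv hv1
  rw [div_le_iff₀ (h.f_p_pos.trans (H.lt ε hε)), sub_le_comm, le_div_iff₀ (sub_pos.2 hsv)]
  linarith

lemma tendsto_reductionR (H : IsVanishingFamily f p c y) (h : IsTangency f m p)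
    (hs : s ∈ Ioo (0 : ℝ) 1) :
    Tendsto (fun ε => reductionR ε (y ε s)) (𝓝[>] 0) (𝓝 (limitSpeed f p s)) := by
  refine tendsto_order.2 ⟨fun r hr => ?_, fun r hr => eventually_mem_nhdsWithin.mono
    fun ε hε => (H.reductionR_le_limitSpeed h hε hs).trans_lt hr⟩
  rcases lt_or_ge s p with hsp | hsp
  · rw [h.limitSpeed_of_le hsp.le] at hr
    refine (H.eventually_lt_reductionR_of_le_sub h hs.1.le hsp.le
      (sub_pos.2 (h.primitive_lt s ⟨hs.1, hsp⟩)) (fun x hx => ?_) hr).mono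
      fun ε hε => hε s ⟨le_rfl, le_rfl⟩
    rw [le_antisymm hx.2 hx.1]
  · rw [limitSpeed, max_eq_left hsp] at hr
    exact H.eventually_lt_reductionR_of_ge h hsp hs.2 hr

lemma exists_eventually_le_reductionR (H : IsVanishingFamily f p c y) (h : IsTangency f m p)
    (ha : 0 < a) (hb : b < 1) :
    ∃ r > 0, ∀ᶠ ε in 𝓝[>] (0 : ℝ), ∀ s ∈ Icc a b, r ≤ reductionR ε (y ε s) := by
  have hleft : ∀ᶠ ε in 𝓝[>] (0 : ℝ), ∀ s ∈ Icc a m, 1 / 2 < reductionR ε (y ε s) := by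
    rcases lt_or_ge m a with ham | ham
    · exact Eventually.of_forall fun ε s hs => absurd (hs.1.trans hs.2) ham.not_ge
    have hcont : ContinuousOn (fun s => f p * s - primitive f s) (Icc a m) :=
      ContinuousOn.sub (by fun_prop) ((continuousOn_primitive h.continuousOn).mono
        (Icc_subset_Icc ha.le (h.m_lt.trans h.lt_one).le))
    obtain ⟨t, ht, hmin⟩ := isCompact_Icc.exists_isMinOn (nonempty_Icc.2 ham) hcont
    exact H.eventually_lt_reductionR_of_le_sub h ha.le h.m_lt.le
      (sub_pos.2 (h.primitive_lt t ⟨ha.trans_le ht.1, ht.2.trans_lt h.m_lt⟩))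
      (fun s hs => hmin hs) one_half_lt_one
  have hb' : max b p ∈ Ioo (0 : ℝ) 1 := ⟨lt_max_of_lt_right h.p_pos, max_lt hb h.lt_one⟩
  have hpos := h.limitSpeed_pos hb'
  refine ⟨min (1 / 2) (limitSpeed f p (max b p) / 2), by positivity, ?_⟩
  filter_upwards [hleft, (H.tendsto_reductionR h hb').eventually (lt_mem_nhds (half_lt_self hpos)),
    self_mem_nhdsWithin] with ε hlow hlim hε s hs
  have hy := H.isTerminalSolution ε hε
  rcases le_total s m with hsm | hsm
  · exact (min_le_left _ _).trans (hlow s ⟨hs.1, hsm⟩).le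
  · refine (min_le_right _ _).trans (hlim.le.trans (reductionR_mono hε (hy.pos _ hb').le ?_))
    have hsb : s ≤ max b p := hs.2.trans (le_max_left _ _)
    exact h.antitoneOn_terminalSolution hy hε (h.f_p_pos.trans (H.lt ε hε)).le
      ⟨hsm, hsb.trans hb'.2.le⟩ ⟨hsm.trans hsb, hb'.2.le⟩ hsb

lemma tendsto_timeMap (H : IsVanishingFamily f p c y) (h : IsTangency f m p)
    (hs₀ : s₀ ∈ Ioo (0 : ℝ) 1) (hs : s ∈ Ioo (0 : ℝ) 1) :
    Tendsto (fun ε => timeMap (fun r => reductionR ε (y ε r)) s₀ s) (𝓝[>] 0)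
      (𝓝 (timeMap (limitSpeed f p) s₀ s)) := by
  have hsub : uIoc s₀ s ⊆ Ioo 0 1 :=
    uIoc_subset_uIcc.trans (ordConnected_Ioo.uIcc_subset hs₀ hs)
  obtain ⟨r, hr, hev⟩ := H.exists_eventually_le_reductionR h (a := min s₀ s) (b := max s₀ s)
    (lt_min hs₀.1 hs.1) (max_lt hs₀.2 hs.2)
  refine intervalIntegral.tendsto_integral_filter_of_dominated_convergence (fun _ => r⁻¹) ?_ ?_
    intervalIntegrable_const (Eventually.of_forall fun x hx =>
      (H.tendsto_reductionR h (hsub hx)).inv₀ (h.limitSpeed_pos (hsub hx)).ne')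
  · filter_upwards [self_mem_nhdsWithin] with ε hε
    have hy := H.isTerminalSolution ε hε
    exact (((continuousOn_reductionR hε).comp (hy.continuousOn.mono
      (hsub.trans Ioo_subset_Icc_self)) fun x hx => (hy.pos x (hsub hx)).le).inv₀ fun x hx =>
      (reductionR_pos hε (hy.pos x (hsub hx))).ne').aestronglyMeasurable measurableSet_uIoc
  · filter_upwards [hev] with ε hle
    refine Eventually.of_forall fun x hx => ?_
    have hrx := hle x (uIoc_subset_uIcc hx)
    rw [Real.norm_of_nonneg (inv_nonneg.2 (hr.le.trans hrx))]
    exact inv_anti₀ hr hrx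

end IsVanishingFamily

/-! ### Convergence of monotone profiles -/

section MonotoneConvergence

variable {ι : Type*} {l : Filter ι} {V : ℝ → ℝ} {a b η s₀ z : ℝ}

lemma exists_finset_forall_lt_add (hc : Continuous V) (hm : Monotone V)
    (hbot : Tendsto V atBot (𝓝 a)) (htop : Tendsto V atTop (𝓝 b)) (hη : 0 < η) :
    ∃ S : Finset ℝ, ∀ z, (V z < a + η ∨ ∃ x ∈ S, x ≤ z ∧ V z < V x + η) ∧
      (b < V z + η ∨ ∃ x ∈ S, z ≤ x ∧ V x < V z + η) := by
  have hloc : ∀ t, ∃ A B, Icc A B ∈ 𝓝 t ∧ V B < V A + η := fun t => by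
    obtain ⟨A, B, ht, hnhds, hsub⟩ := exists_Icc_mem_subset_of_mem_nhds
      (hc.continuousAt.preimage_mem_nhds (Ioo_mem_nhds (sub_lt_self (V t) (half_pos hη))
        (lt_add_of_pos_right (V t) (half_pos hη))))
    have hA := (hsub (left_mem_Icc.2 (ht.1.trans ht.2))).1
    have hB := (hsub (right_mem_Icc.2 (ht.1.trans ht.2))).2
    exact ⟨A, B, hnhds, by linarith⟩
  choose A B hnhds hAB using hloc
  obtain ⟨L, hL⟩ := (hbot.eventually_lt_const (lt_add_of_pos_right a hη)).exists
  obtain ⟨R, hR⟩ := (htop.eventually_const_lt (sub_lt_self b hη)).exists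
  obtain ⟨T, -, hT⟩ := (isCompact_Icc (a := L) (b := R)).elim_nhds_subcover
    (fun t => Icc (A t) (B t)) fun t _ => hnhds t
  refine ⟨insert L (insert R (T.image A ∪ T.image B)), fun z => ?_⟩
  rcases le_or_gt z L with hzL | hLz
  · exact ⟨.inl ((hm hzL).trans_lt hL), .inr ⟨L, by simp, hzL, by
      linarith [hm.le_of_tendsto hbot z]⟩⟩
  rcases le_or_gt R z with hRz | hzR
  · exact ⟨.inr ⟨R, by simp, hRz, by linarith [hm.ge_of_tendsto htop z]⟩,
      .inl (by linarith [hm hRz])⟩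
  obtain ⟨t, ht, hzt⟩ := mem_iUnion₂.1 (hT ⟨hLz.le, hzR.le⟩)
  exact ⟨.inr ⟨A t, by simp [Finset.mem_image_of_mem A ht], hzt.1, (hm hzt.2).trans_lt (hAB t)⟩,
    .inr ⟨B t, by simp [Finset.mem_image_of_mem B ht], hzt.2, by linarith [hAB t, hm hzt.1]⟩⟩

lemma tendstoUniformly_of_monotone {v : ι → ℝ → ℝ}
    (hv : ∀ᶠ i in l, Monotone (v i) ∧ ∀ z, v i z ∈ Icc a b) (hc : Continuous V)
    (hm : Monotone V) (hbot : Tendsto V atBot (𝓝 a)) (htop : Tendsto V atTop (𝓝 b))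
    (hlim : ∀ z, Tendsto (fun i => v i z) l (𝓝 (V z))) : TendstoUniformly v V l := by
  refine Metric.tendstoUniformly_iff.2 fun η hη => ?_
  obtain ⟨S, hS⟩ := exists_finset_forall_lt_add hc hm hbot htop (half_pos hη)
  have hclose : ∀ᶠ i in l, ∀ x ∈ S, |v i x - V x| < η / 2 :=
    (eventually_all_finset S).2 fun x _ =>
      (hlim x).eventually (Metric.ball_mem_nhds _ (half_pos hη))
  filter_upwards [hv, hclose] with i ⟨hmono, hmem⟩ hclose z
  obtain ⟨hlow, hup⟩ := hS z
  rw [dist_comm, Real.dist_eq, abs_lt]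
  constructor
  · rcases hlow with hlow | ⟨x, hx, hxz, hlow⟩
    · linarith [(hmem z).1]
    · linarith [hmono hxz, (abs_lt.1 (hclose x hx)).1]
  · rcases hup with hup | ⟨x, hx, hzx, hup⟩
    · linarith [(hmem z).2]
    · linarith [hmono hzx, (abs_lt.1 (hclose x hx)).2]

lemma tendsto_flow_of_tendsto_timeMap {G v : ι → ℝ → ℝ} {T : ℝ → ℝ} {hs₀ : s₀ ∈ Ioo a b}
    (hv : ∀ᶠ i in l, ∃ h : IsSpeedField (G i) a b, v i = h.flow hs₀) (hm : Monotone V)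
    (hV : V z ∈ Icc a b) (hT : ∀ s ∈ Ioo a b, V (T s) = s)
    (hlim : ∀ s ∈ Ioo a b, Tendsto (fun i => timeMap (G i) s₀ s) l (𝓝 (T s))) :
    Tendsto (fun i => v i z) l (𝓝 (V z)) := by
  refine tendsto_order.2 ⟨fun s hs => ?_, fun s hs => ?_⟩
  · rcases le_or_gt s a with hsa | has
    · filter_upwards [hv] with i ⟨h, hvi⟩
      exact hvi ▸ hsa.trans_lt (h.flow_mem hs₀ z).1
    have hsI : s ∈ Ioo a b := ⟨has, hs.trans_le hV.2⟩
    have hTz : T s < z := hm.reflect_lt (by rwa [hT s hsI])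
    filter_upwards [hv, (hlim s hsI).eventually_lt_const hTz] with i ⟨h, hvi⟩ hlt
    rw [hvi, ← h.flow_timeMap hs₀ hsI]
    exact h.strictMono_flow hs₀ hlt
  · rcases le_or_gt b s with hbs | hsb
    · filter_upwards [hv] with i ⟨h, hvi⟩
      exact hvi ▸ (h.flow_mem hs₀ z).2.trans_le hbs
    have hsI : s ∈ Ioo a b := ⟨hV.1.trans_lt hs, hsb⟩
    have hzT : z < T s := hm.reflect_lt (by rwa [hT s hsI])
    filter_upwards [hv, (hlim s hsI).eventually_const_lt hzT] with i ⟨h, hvi⟩ hlt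
    rw [hvi, ← h.flow_timeMap hs₀ hsI]
    exact h.strictMono_flow hs₀ hlt

end MonotoneConvergence

/-! ### Inviscid profiles -/

section Inviscid

variable {f V : ℝ → ℝ} {c z₀ v₀ : ℝ}

lemma ConditionH.nonneg (hH : ConditionH f) (hA : IsTypeA f) : ∀ s ∈ Icc (0 : ℝ) 1, 0 ≤ f s := by
  rintro s ⟨h0, h1⟩
  rcases h0.eq_or_lt with rfl | h0
  · exact hH.zero.ge
  rcases h1.eq_or_lt with rfl | h1
  · exact hH.one.ge
  · exact (hA s ⟨h0, h1⟩).le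

lemma ConditionH.isSpeedField_div (hH : ConditionH f) (hA : IsTypeA f) (hc : 0 < c) :
    IsSpeedField (fun s => f s / c) 0 1 := by
  obtain ⟨k, hk0, hk⟩ := hH.linear_control
  refine ⟨(hH.continuousOn.mono Ioo_subset_Icc_self).div_const _,
    fun s hs => div_pos (hA s hs) hc, k / c, by positivity, fun s hs => ?_⟩
  obtain ⟨hleft, hright⟩ := hk s (Ioo_subset_Icc_self hs)
  rw [div_mul_eq_mul_div, div_mul_eq_mul_div, sub_zero]
  exact ⟨div_le_div_of_nonneg_right (le_of_abs_le hleft) hc.le,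
    div_le_div_of_nonneg_right (le_of_abs_le hright) hc.le⟩

namespace IsInviscidSolution

lemma hasDerivAt (hV : IsInviscidSolution f c z₀ v₀ V) (hc : 0 < c) (z : ℝ) :
    HasDerivAt V (f (V z) / c) z := by
  rw [← hV.equation z, mul_div_cancel_left₀ _ hc.ne']
  exact (hV.differentiable z).hasDerivAt

lemma lt_one (hV : IsInviscidSolution f c z₀ v₀ V) (hH : ConditionH f) (hA : IsTypeA f)
    (hc : 0 < c) (hv₀ : v₀ < 1) (z : ℝ) : V z < 1 := by
  have hmem : ∀ x, V x ∈ Icc (0 : ℝ) 1 := fun x => ⟨(hV.pos x).le, hV.le_one x⟩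
  rcases le_total z₀ z with hz | hz
  · obtain ⟨k, -, hk⟩ := hH.linear_control
    have hpos : 0 < 1 - V z := by
      refine pos_of_neg_mul_le_hasDerivAt (N := fun x => 1 - V x) (C := k / c)
        (fun x => (hV.hasDerivAt hc x).const_sub 1) (fun x => ?_)
        (sub_pos.2 (hV.initial.trans_lt hv₀)) hz
      rw [neg_mul, neg_le_neg_iff, div_mul_eq_mul_div]
      exact div_le_div_of_nonneg_right (le_of_abs_le (hk _ (hmem x)).2) hc.le
    exact sub_pos.1 hpos
  · have hmono : Monotone V := monotone_of_hasDerivAt_nonneg (hV.hasDerivAt hc) fun x =>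
      div_nonneg (hH.nonneg hA _ (hmem x)) hc.le
    exact (hmono hz).trans_lt (hV.initial.trans_lt hv₀)

end IsInviscidSolution

lemma ConditionH.isProfileI_flow (hH : ConditionH f) (hA : IsTypeA f) (hc : 0 < c)
    (hv₀ : v₀ ∈ Ioo (0 : ℝ) 1) (z₀ : ℝ) :
    IsProfileI f c z₀ v₀ fun z => (hH.isSpeedField_div hA hc).flow hv₀ (z - z₀) := by
  set hG := hH.isSpeedField_div hA hc
  have hd : ∀ z, HasDerivAt (fun z => hG.flow hv₀ (z - z₀)) (f (hG.flow hv₀ (z - z₀)) / c) z :=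
    fun z => (hG.hasDerivAt_flow hv₀ (z - z₀)).comp_sub_const z z₀
  refine ⟨⟨fun z => (hG.flow_mem hv₀ _).1, fun z => (hG.flow_mem hv₀ _).2.le,
    fun z => (hd z).differentiableAt, fun z => ?_, ?_⟩, fun W hW => funext fun z => ?_⟩
  · rw [(hd z).deriv, mul_div_cancel₀ _ hc.ne']
  · rw [sub_self, hG.flow_zero]
  · obtain rfl := hW.initial
    exact hG.eq_flow (fun x => ⟨hW.pos x, hW.lt_one hH hA hc hv₀.2 x⟩) (hW.hasDerivAt hc) hv₀ z

end Inviscid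

/-! ### The limit profile -/

/-- A profile of `f(p) V' = f(V)` with values in `(0, 1)` that passes through `p` at `z₀`: the
right-hand piece of the limit profile. -/
structure IsInviscidFront (f : ℝ → ℝ) (p z₀ : ℝ) (V : ℝ → ℝ) : Prop where
  mem : ∀ z, V z ∈ Ioo (0 : ℝ) 1
  hasDerivAt : ∀ z, HasDerivAt V (f (V z) / f p) z
  apply_eq : V z₀ = p
  tendsto_atTop : Tendsto V atTop (𝓝 1)

lemma glue_profileL_apply {p : ℝ} (hp : p < 1) (z₀ z : ℝ) (V : ℝ → ℝ) :
    glue z₀ (profileL z₀ p) V z = if z ≤ z₀ then max 0 (z - z₀ + p) else V z := by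
  unfold glue profileL
  split_ifs
  · rw [max_eq_left]; linarith
  · rw [max_eq_right]; linarith
  · linarith
  · rfl

lemma profileL_eq_of_sub_eq {z₀ v₀ z₁ v₁ : ℝ} (h : z₀ - v₀ = z₁ - v₁) :
    profileL z₀ v₀ = profileL z₁ v₁ := by
  funext z
  have hcorner : 1 + z₀ - v₀ = 1 + z₁ - v₁ := by linarith
  have hline : z - z₀ + v₀ = z - z₁ + v₁ := by linarith
  rw [profileL, profileL, h, hcorner, hline]

lemma IsSpeedField.isInviscidFront {f : ℝ → ℝ} {p s₀ z₀ z₁ : ℝ}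
    (hG : IsSpeedField (fun s => f s / f p) 0 1) (hs₀ : s₀ ∈ Ioo (0 : ℝ) 1)
    (hz₀ : hG.flow hs₀ (z₀ - z₁) = p) :
    IsInviscidFront f p z₀ fun z => hG.flow hs₀ (z - z₁) where
  mem z := hG.flow_mem hs₀ (z - z₁)
  hasDerivAt z := (hG.hasDerivAt_flow hs₀ (z - z₁)).comp_sub_const z z₁
  apply_eq := hz₀
  tendsto_atTop := (hG.tendsto_flow_atTop hs₀).comp (tendsto_atTop_add_const_right _ _ tendsto_id)

namespace IsInviscidFront

variable {f V : ℝ → ℝ} {m p s s₀ z₀ z : ℝ}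

lemma monotone (hV : IsInviscidFront f p z₀ V) (h : IsTangency f m p) : Monotone V :=
  monotone_of_hasDerivAt_nonneg hV.hasDerivAt fun z =>
    (div_pos (h.pos _ (hV.mem z)) h.f_p_pos).le

lemma glue_of_le_sub (hV : IsInviscidFront f p z₀ V) (hz : z ≤ z₀ - p) :
    glue z₀ (profileL z₀ p) V z = 0 := by
  have hp : p ∈ Ioo (0 : ℝ) 1 := hV.apply_eq ▸ hV.mem z₀
  rw [glue_profileL_apply hp.2, if_pos (by linarith [hp.1]), max_eq_left (by linarith)]

lemma glue_of_mem_Icc (hV : IsInviscidFront f p z₀ V) (hz : z ∈ Icc (z₀ - p) z₀) :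
    glue z₀ (profileL z₀ p) V z = z - z₀ + p := by
  have hp : p ∈ Ioo (0 : ℝ) 1 := hV.apply_eq ▸ hV.mem z₀
  rw [glue_profileL_apply hp.2, if_pos hz.2, max_eq_right (by linarith [hz.1])]

lemma glue_of_ge (hV : IsInviscidFront f p z₀ V) (hz : z₀ ≤ z) :
    glue z₀ (profileL z₀ p) V z = V z := by
  rcases hz.eq_or_lt with rfl | hz
  · have hp : 0 < p := hV.apply_eq ▸ (hV.mem z₀).1
    rw [hV.glue_of_mem_Icc ⟨by linarith, le_rfl⟩, sub_self, zero_add, hV.apply_eq]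
  · rw [glue, if_neg hz.not_ge]

lemma monotone_glue (hV : IsInviscidFront f p z₀ V) (h : IsTangency f m p) :
    Monotone (glue z₀ (profileL z₀ p) V) := by
  refine MonotoneOn.Iic_union_Ici (a := z₀) ?_ ?_
  · intro x hx y hy hxy
    rw [glue_profileL_apply h.lt_one, glue_profileL_apply h.lt_one,
      if_pos (mem_Iic.1 hx), if_pos (mem_Iic.1 hy)]
    gcongr
  · exact ((hV.monotone h).monotoneOn _).congr fun z hz => (hV.glue_of_ge hz).symm

lemma continuous_glue (hV : IsInviscidFront f p z₀ V) :
    Continuous (glue z₀ (profileL z₀ p) V) := by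
  have hp : p ∈ Ioo (0 : ℝ) 1 := hV.apply_eq ▸ hV.mem z₀
  have hVc : Continuous V := continuous_iff_continuousAt.2 fun z => (hV.hasDerivAt z).continuousAt
  rw [funext fun z => glue_profileL_apply hp.2 z₀ z V]
  refine Continuous.if_le (by fun_prop) hVc continuous_id continuous_const ?_
  rintro z rfl
  rw [sub_self, zero_add, max_eq_right hp.1.le, hV.apply_eq]

lemma glue_mem (hV : IsInviscidFront f p z₀ V) (hz : z₀ - p < z) :
    glue z₀ (profileL z₀ p) V z ∈ Ioo (0 : ℝ) 1 := by
  rcases le_total z z₀ with hzz | hzz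
  · have hp : p < 1 := hV.apply_eq ▸ (hV.mem z₀).2
    rw [hV.glue_of_mem_Icc ⟨hz.le, hzz⟩]
    exact ⟨by linarith, by linarith⟩
  · rw [hV.glue_of_ge hzz]
    exact hV.mem z

lemma lt_of_glue_pos (hV : IsInviscidFront f p z₀ V) (hz : 0 < glue z₀ (profileL z₀ p) V z) :
    z₀ - p < z :=
  lt_of_not_ge fun hle => hz.ne' (hV.glue_of_le_sub hle)

lemma tendsto_glue_atBot (hV : IsInviscidFront f p z₀ V) :
    Tendsto (glue z₀ (profileL z₀ p) V) atBot (𝓝 0) :=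
  tendsto_const_nhds.congr'
    ((eventually_le_atBot (z₀ - p)).mono fun _ hz => (hV.glue_of_le_sub hz).symm)

lemma tendsto_glue_atTop (hV : IsInviscidFront f p z₀ V) :
    Tendsto (glue z₀ (profileL z₀ p) V) atTop (𝓝 1) :=
  hV.tendsto_atTop.congr' ((eventually_ge_atTop z₀).mono fun _ hz => (hV.glue_of_ge hz).symm)

lemma hasDerivAt_glue (hV : IsInviscidFront f p z₀ V) (h : IsTangency f m p) (hz : z₀ - p < z) :
    HasDerivAt (glue z₀ (profileL z₀ p) V)
      (limitSpeed f p (glue z₀ (profileL z₀ p) V z)) z := by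
  have hline : HasDerivAt (fun x => x - z₀ + p) 1 z := ((hasDerivAt_id z).sub_const z₀).add_const p
  rcases lt_trichotomy z z₀ with hlt | rfl | hgt
  · rw [hV.glue_of_mem_Icc ⟨hz.le, hlt.le⟩, h.limitSpeed_of_le (by linarith)]
    refine hline.congr_of_eventuallyEq ?_
    filter_upwards [Icc_mem_nhds hz hlt] with x hx using hV.glue_of_mem_Icc hx
  · rw [hV.glue_of_ge le_rfl, hV.apply_eq, h.limitSpeed_of_le le_rfl,
      ← hasDerivWithinAt_univ, ← Iic_union_Ici (a := z)]
    refine HasDerivWithinAt.union ?_ ?_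
    · refine hline.hasDerivWithinAt.congr_of_eventuallyEq ?_ (hV.glue_of_mem_Icc ⟨hz.le, le_rfl⟩)
      filter_upwards [mem_nhdsWithin_of_mem_nhds (Ici_mem_nhds hz), self_mem_nhdsWithin]
        with x hlow hup using hV.glue_of_mem_Icc ⟨hlow, hup⟩
    · have hVz := hV.hasDerivAt z
      rw [hV.apply_eq, div_self h.f_p_pos.ne'] at hVz
      exact hVz.hasDerivWithinAt.congr (fun x hx => hV.glue_of_ge hx) (hV.glue_of_ge le_rfl)
  · have hpV : p ≤ V z := hV.apply_eq.ge.trans (hV.monotone h hgt.le)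
    rw [hV.glue_of_ge hgt.le, limitSpeed, max_eq_left hpV]
    refine (hV.hasDerivAt z).congr_of_eventuallyEq ?_
    filter_upwards [Ici_mem_nhds hgt] with x hx using hV.glue_of_ge hx

lemma deriv_glue (hV : IsInviscidFront f p z₀ V) (h : IsTangency f m p) :
    deriv (glue z₀ (profileL z₀ p) V) z₀ = 1 := by
  rw [(hV.hasDerivAt_glue h (sub_lt_self z₀ h.p_pos)).deriv, hV.glue_of_ge le_rfl, hV.apply_eq,
    h.limitSpeed_of_le le_rfl]

lemma contDiffAt_glue (hV : IsInviscidFront f p z₀ V) (h : IsTangency f m p) :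
    ContDiffAt ℝ 1 (glue z₀ (profileL z₀ p) V) z₀ := by
  have hcont : ContDiffOn ℝ (0 + 1) (glue z₀ (profileL z₀ p) V) (Ioi (z₀ - p)) := by
    refine (contDiffOn_succ_iff_deriv_of_isOpen isOpen_Ioi).2
      ⟨fun z hz => (hV.hasDerivAt_glue h hz).differentiableAt.differentiableWithinAt, by simp, ?_⟩
    exact contDiffOn_zero.2 ((h.continuousOn_limitSpeed.comp hV.continuous_glue.continuousOn
      fun z hz => hV.glue_mem hz).congr fun z hz => (hV.hasDerivAt_glue h hz).deriv)
  rw [zero_add] at hcont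
  exact hcont.contDiffAt (Ioi_mem_nhds (sub_lt_self z₀ h.p_pos))

lemma glue_timeMap (hV : IsInviscidFront f p z₀ V) (h : IsTangency f m p)
    (hs₀ : s₀ ∈ Ioo (0 : ℝ) 1) (h0 : glue z₀ (profileL z₀ p) V 0 = s₀)
    (hs : s ∈ Ioo (0 : ℝ) 1) :
    glue z₀ (profileL z₀ p) V (timeMap (limitSpeed f p) s₀ s) = s := by
  obtain ⟨z, rfl⟩ := mem_range_of_exists_le_of_exists_ge hV.continuous_glue
    ((hV.tendsto_glue_atBot.eventually_le_const hs.1).exists)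
    ((hV.tendsto_glue_atTop.eventually_const_le hs.2).exists)
  have htime := timeMap_sub_timeMap_comp h.continuousOn_limitSpeed (fun s hs => h.limitSpeed_pos hs)
    hs₀ isOpen_Ioi (convex_Ioi (z₀ - p)) (fun z hz => hV.glue_mem hz)
    (fun z hz => hV.hasDerivAt_glue h hz) (hV.lt_of_glue_pos hs.1)
    (hV.lt_of_glue_pos (h0 ▸ hs₀.1))
  rw [h0, timeMap_self, sub_zero, sub_zero] at htime
  rw [htime]

lemma convergesToGluing {c : ℝ → ℝ} {v y : ℝ → ℝ → ℝ} {hs₀ : s₀ ∈ Ioo (0 : ℝ) 1}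
    (hV : IsInviscidFront f p z₀ V) (h : IsTangency f m p) (H : IsVanishingFamily f p c y)
    (hv : ∀ ε > 0, ∃ hG : IsSpeedField (fun s => reductionR ε (y ε s)) 0 1, v ε = hG.flow hs₀)
    (h0 : glue z₀ (profileL z₀ p) V 0 = s₀) :
    ConvergesToGluing v (glue z₀ (profileL z₀ p) V) z₀ := by
  have hm := hV.monotone_glue h
  have hmem : ∀ z, glue z₀ (profileL z₀ p) V z ∈ Icc (0 : ℝ) 1 := fun z =>
    ⟨hm.le_of_tendsto hV.tendsto_glue_atBot z, hm.ge_of_tendsto hV.tendsto_glue_atTop z⟩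
  refine ⟨tendstoUniformly_of_monotone (eventually_mem_nhdsWithin.mono fun ε hε => ?_)
    hV.continuous_glue hm hV.tendsto_glue_atBot hV.tendsto_glue_atTop fun z => ?_,
    hV.contDiffAt_glue h, hV.deriv_glue h⟩
  · obtain ⟨hG, hvε⟩ := hv ε hε
    rw [hvε]
    exact ⟨(hG.strictMono_flow hs₀).monotone, fun z => Ioo_subset_Icc_self (hG.flow_mem hs₀ z)⟩
  · exact tendsto_flow_of_tendsto_timeMap (eventually_mem_nhdsWithin.mono hv) hm (hmem z)
      (fun s hs => hV.glue_timeMap h hs₀ h0 hs) fun s hs => H.tendsto_timeMap h hs₀ hs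

end IsInviscidFront

/-! ### Convergence of the critical profiles -/

lemma normV0_mem_Ioo : normV0 ∈ Ioo (0 : ℝ) 1 := by
  norm_num [normV0]

section Convergence

variable {f c : ℝ → ℝ} {v y : ℝ → ℝ → ℝ} {m p k : ℝ}

namespace IsVanishingFamily

lemma exists_normalizedProfile (H : IsVanishingFamily f p c y) (h : IsTangency f m p)
    (hpos : ∀ s ∈ Icc (0 : ℝ) 1, 0 ≤ f s) (hk : ∀ s ∈ Icc (0 : ℝ) 1, f s ≤ k * (1 - s)) :
    ∃ v : ℝ → ℝ → ℝ, ∀ ε > 0, IsNormalizedProfile f ε (c ε) (v ε) ∧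
      (∀ w, IsNormalizedProfile f ε (c ε) w → w = v ε) ∧
      ∃ hG : IsSpeedField (fun s => reductionR ε (y ε s)) 0 1, v ε = hG.flow normV0_mem_Ioo := by
  have hexists : ∀ ε : ℝ, ∃ v : ℝ → ℝ, 0 < ε → IsNormalizedProfile f ε (c ε) v ∧
      (∀ w, IsNormalizedProfile f ε (c ε) w → w = v) ∧
      ∃ hG : IsSpeedField (fun s => reductionR ε (y ε s)) 0 1, v = hG.flow normV0_mem_Ioo :=
    fun ε => by
      by_cases hε : 0 < ε
      · have hc := (h.f_p_pos.trans (H.lt ε hε)).le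
        have hy := H.isTerminalSolution ε hε
        have hG := hy.isSpeedField hε hc (H.zero ε hε) h.pos hk
        refine ⟨hG.flow normV0_mem_Ioo, fun _ => ⟨⟨hy.isHeteroclinic_flow hε h.continuousOn hG
          normV0_mem_Ioo, hG.flow_zero normV0_mem_Ioo⟩, fun w hw => ?_, hG, rfl⟩⟩
        have hw0 : w 0 ∈ Ioo (0 : ℝ) 1 := hw.2 ▸ normV0_mem_Ioo
        rw [hw.1.eq_flow hy hε hc hpos hk hG hw0]
        congr 1
        exact hw.2
      · exact ⟨0, fun hε' => absurd hε' hε⟩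
  choose v hv using hexists
  exact ⟨v, hv⟩

lemma exists_convergesToGluing_of_le (H : IsVanishingFamily f p c y) (h : IsTangency f m p)
    (hH : ConditionH f) (hA : IsTypeA f)
    (hv : ∀ ε > 0, ∃ hG : IsSpeedField (fun s => reductionR ε (y ε s)) 0 1,
      v ε = hG.flow normV0_mem_Ioo) (hp : normV0 ≤ p) :
    ∃ V, IsProfileI f (f p) (p - normV0) p V ∧
      ConvergesToGluing v (glue (p - normV0) (profileL 0 normV0) V) (p - normV0) := by
  have hprofile := hH.isProfileI_flow hA h.f_p_pos h.p_mem (p - normV0)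
  have hV := (hH.isSpeedField_div hA h.f_p_pos).isInviscidFront h.p_mem hprofile.1.initial
  refine ⟨_, hprofile, ?_⟩
  rw [profileL_eq_of_sub_eq (show 0 - normV0 = p - normV0 - p by ring)]
  refine hV.convergesToGluing h H hv ?_
  rw [hV.glue_of_mem_Icc ⟨by linarith [normV0_mem_Ioo.1], sub_nonneg.2 hp⟩]
  ring

lemma exists_convergesToGluing_of_lt (H : IsVanishingFamily f p c y) (h : IsTangency f m p)
    (hH : ConditionH f) (hA : IsTypeA f)
    (hv : ∀ ε > 0, ∃ hG : IsSpeedField (fun s => reductionR ε (y ε s)) 0 1,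
      v ε = hG.flow normV0_mem_Ioo) (hp : p < normV0) :
    ∃ V, IsProfileI f (f p) 0 normV0 V ∧ ∃ zplus < 0, V zplus = p ∧ (∀ z, V z = p → z = zplus) ∧
      ConvergesToGluing v (glue zplus (profileL zplus p) V) zplus := by
  have hG := hH.isSpeedField_div hA h.f_p_pos
  have hprofile := hH.isProfileI_flow hA h.f_p_pos normV0_mem_Ioo 0
  set zplus := timeMap (fun s => f s / f p) normV0 p
  have hneg : zplus < 0 := by
    rw [← timeMap_self (fun s => f s / f p) normV0]
    exact strictMonoOn_timeMap hG.continuousOn hG.pos normV0_mem_Ioo h.p_mem normV0_mem_Ioo hp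
  have hmeet : hG.flow normV0_mem_Ioo (zplus - 0) = p := by
    rw [sub_zero, hG.flow_timeMap normV0_mem_Ioo h.p_mem]
  have hV := hG.isInviscidFront normV0_mem_Ioo hmeet
  refine ⟨_, hprofile, zplus, hneg, hmeet, fun z hz => ?_, hV.convergesToGluing h H hv ?_⟩
  · exact sub_left_injective ((hG.strictMono_flow normV0_mem_Ioo).injective (hz.trans hmeet.symm))
  · rw [hV.glue_of_ge hneg.le]
    exact hprofile.1.initial

end IsVanishingFamily

end Convergence

theorem mainTheorem1_general (f : ℝ → ℝ) (hH : ConditionH f) (hA : IsTypeA f)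
    (hmax : ∃! m : ℝ, m ∈ Ioo (0 : ℝ) 1 ∧ IsLocalMax f m) :
    ∃ (cstar : ℝ → ℝ) (v : ℝ → ℝ → ℝ),
      (∀ ε : ℝ, 0 < ε →
        IsCriticalSpeed f ε (cstar ε) ∧
        IsNormalizedProfile f ε (cstar ε) (v ε) ∧
        ∀ w : ℝ → ℝ, IsNormalizedProfile f ε (cstar ε) w → w = v ε) ∧
      ∃ vplus ∈ Ioo (0 : ℝ) 1,
        IsGreatest {u : ℝ | u ∈ Icc (0 : ℝ) 1 ∧ primitive f u = u * f u} vplus ∧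
        Tendsto cstar (𝓝[>] (0 : ℝ)) (𝓝 (f vplus)) ∧
        (normV0 ≤ vplus →
          ∃ V : ℝ → ℝ, IsProfileI f (f vplus) (vplus - normV0) vplus V ∧
            ConvergesToGluing v
              (glue (vplus - normV0) (profileL 0 normV0) V) (vplus - normV0)) ∧
        (vplus < normV0 →
          ∃ V : ℝ → ℝ, IsProfileI f (f vplus) 0 normV0 V ∧
            ∃ zplus : ℝ, zplus < 0 ∧ V zplus = vplus ∧ (∀ z : ℝ, V z = vplus → z = zplus) ∧
              ConvergesToGluing v
                (glue zplus (profileL zplus vplus) V) zplus) := by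
  obtain ⟨m, p, h⟩ := exists_isTangency hH hA hmax
  obtain ⟨k, -, hk⟩ := hH.linear_control
  obtain ⟨c, y, hcrit, H⟩ := h.exists_isVanishingFamily fun s hs => le_of_abs_le (hk s hs).1
  obtain ⟨v, hv⟩ := H.exists_normalizedProfile h (hH.nonneg hA) fun s hs =>
    le_of_abs_le (hk s hs).2
  have hflow := fun ε hε => (hv ε hε).2.2
  exact ⟨c, v, fun ε hε => ⟨hcrit ε hε, (hv ε hε).1, (hv ε hε).2.1⟩, p, h.p_mem, h.isGreatest,
    H.tendsto, H.exists_convergesToGluing_of_le h hH hA hflow,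
    H.exists_convergesToGluing_of_lt h hH hA hflow⟩

theorem mainTheorem1 (f : ℝ → ℝ) (hH : ConditionH f) (hA : IsTypeA f) (hF : ConditionF f) :
    ∃ (cstar : ℝ → ℝ) (v : ℝ → ℝ → ℝ),
      -- critical speeds and critical profiles, for every `ε > 0`
      (∀ ε : ℝ, 0 < ε →
        IsCriticalSpeed f ε (cstar ε) ∧
        IsNormalizedProfile f ε (cstar ε) (v ε) ∧
        ∀ w : ℝ → ℝ, IsNormalizedProfile f ε (cstar ε) w → w = v ε) ∧
      ∃ vplus ∈ Ioo (0 : ℝ) 1,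
        IsGreatest {u : ℝ | u ∈ Icc (0 : ℝ) 1 ∧ primitive f u = u * f u} vplus ∧
        Tendsto cstar (𝓝[>] (0 : ℝ)) (𝓝 (f vplus)) ∧
        (normV0 ≤ vplus →
          ∃ V : ℝ → ℝ, IsProfileI f (f vplus) (vplus - normV0) vplus V ∧
            ConvergesToGluing v
              (glue (vplus - normV0) (profileL 0 normV0) V) (vplus - normV0)) ∧
        (vplus < normV0 →
          ∃ V : ℝ → ℝ, IsProfileI f (f vplus) 0 normV0 V ∧
            ∃ zplus : ℝ, zplus < 0 ∧ V zplus = vplus ∧ (∀ z : ℝ, V z = vplus → z = zplus) ∧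
              ConvergesToGluing v
                (glue zplus (profileL zplus vplus) V) zplus) :=
  mainTheorem1_general f hH hA hF.unique_localMax
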